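/- Let $\mathcal C^+=\{1,2,3,\dots\}\cup\{\aleph_0,2^{\aleph_0}\}$. For an equivalence relation $E$ on a standard Borel space $X$, the *fine shape* of $E$ is the function $\mathrm{fs}(E)$ on $\mathcal C^+$ that sends $\mathfrak m$ to the number (cardinality of the set) of $E$-classes of cardinality $\mathfrak m$. Equivalence relations $E$ on $X$ and $F$ on $Y$ are *Borel isomorphic*, $E\cong_B F$, if there is a Borel bijection $f:X\to Y$ with $x\mathrel{E}x'\Leftrightarrow f(x)\mathrel{F}f(x')$ for all $x,x'\in X$. $E$ is *smooth* if there are a standard Borel space $W$ and a Borel function $g:X\to W$ with $x\mathrel{E}x'\Leftrightarrow g(x)=g(x')$ for all $x,x'\in X$. $E$ is *Borel parametrized* if there are a pairwise disjoint family $(Z_{\mathfrak m})_{\mathfrak m\in\mathcal C^+}$ of (possibly empty) standard Borel spaces, a family $(Y_{\mathfrak m})_{\mathfrak m\in\mathcal C^+}$ of standard Borel spaces with $|Y_{\mathfrak m}|=\mathfrak m$, and a Borel bijection $\varphi:X\to\bigsqcup_{\mathfrak m\in\mathcal C^+}(Z_{\mathfrak m}\times Y_{\mathfrak m})$ such that,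 with $\pi_1$ the projection to $\bigsqcup_{\mathfrak m} Z_{\mathfrak m}$, one has $x\mathrel{E}x'\Leftrightarrow \pi_1(\varphi(x))=\pi_1(\varphi(x'))$ for all $x,x'\in X$. **Theorem.** If $E$ and $F$ are Borel parametrized equivalence relations on standard Borel spaces, then $E\cong_B F$ if and only if $\mathrm{fs}(E)=\mathrm{fs}(F)$. Moreover, if $E$ is a smooth equivalence relation on a standard Borel space that is not Borel parametrized, then there exists a smooth equivalence relation $F$ on a standard Borel space such that $\mathrm{fs}(E)=\mathrm{fs}(F)$ but $E\not\cong_B F$. -/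

import Mathlib

open Cardinal

universe u

/-- The set `𝒞⁺ = {1, 2, 3, …} ∪ {ℵ₀, 2^ℵ₀}` of the possible cardinalities of nonempty Borel sets. -/
def CPlus : Set Cardinal.{u} :=
  {m | m ≠ 0 ∧ (m ≤ ℵ₀ ∨ m = 𝔠)}

/-- A Borel reduction of the equivalence relation `E` to the equivalence relation `F`. -/
def IsBorelReduction {X Y : Type u} [MeasurableSpace X] [MeasurableSpace Y]
    (E : Setoid X) (F : Setoid Y) (f : X → Y) : Prop :=
  Measurable f ∧ ∀ x y : X, E.r x y ↔ F.r (f x) (f y)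

/-- `E ≅_B F`: there is a bijective Borel reduction of `E` to `F`. -/
def BorelIsomorphic {X Y : Type u} [MeasurableSpace X] [MeasurableSpace Y]
    (E : Setoid X) (F : Setoid Y) : Prop :=
  ∃ f : X → Y, IsBorelReduction E F f ∧ Function.Bijective f

/-- `E` is smooth: it is Borel reducible to the equality relation (the setoid `⊥`) of some
standard Borel space. -/
def IsSmooth {X : Type u} [MeasurableSpace X] (E : Setoid X) : Prop :=
  ∃ (Y : Type u) (_ : MeasurableSpace Y) (_ : StandardBorelSpace Y) (f : X → Y),
    IsBorelReduction E (⊥ : Setoid Y) f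

/-- The fine shape of `E`: it sends `m ∈ 𝒞⁺` to the number of `E`-classes of cardinality `m`. -/
noncomputable def fineShape {X : Type u} (E : Setoid X) (m : ↥CPlus.{u}) :
    Cardinal.{u} :=
  #{C : Set X // C ∈ E.classes ∧ #C = (m : Cardinal.{u})}

/-- The natural projection `⊔ₘ (Zₘ × Yₘ) → ⊔ₘ Zₘ` of (external) disjoint unions. -/
def sigmaFst {ι : Type*} {Z Y : ι → Type*} (p : Σ m, Z m × Y m) : Σ m, Z m :=
  ⟨p.1, p.2.1⟩

/-- `E` is Borel parametrized: there are standard Borel spaces `Zₘ` (possibly empty) and `Yₘ`,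
with `|Yₘ| = m`, for `m ∈ 𝒞⁺`, and a Borel bijection `φ` of `X` with the disjoint union of the
`Zₘ × Yₘ` such that two points are `E`-equivalent iff their images have the same coordinate in the
disjoint union of the `Zₘ`. The external disjoint union makes the `Zₘ` pairwise disjoint; it
carries Mathlib's measurable structure on `Sigma` types, in which a set is measurable iff its
intersection with each summand is. -/
def IsBorelParametrized {X : Type u} [MeasurableSpace X] (E : Setoid X) : Prop :=
  ∃ (Z Y : ↥CPlus.{u} → Type u)
    (_ : ∀ m, MeasurableSpace (Z m)) (_ : ∀ m, StandardBorelSpace (Z m))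
    (_ : ∀ m, MeasurableSpace (Y m)) (_ : ∀ m, StandardBorelSpace (Y m))
    (φ : X → Σ m, Z m × Y m),
    (∀ m, #(Y m) = (m : Cardinal.{u})) ∧
    Measurable φ ∧ Function.Bijective φ ∧
    ∀ x y : X, E.r x y ↔ sigmaFst (φ x) = sigmaFst (φ y)

/-! For parametrized relations, `fineShape E m` is the cardinality of the parameter space `Z m`.
Standard Borel spaces of equal cardinality are Borel isomorphic, so equal fine shapes give
isomorphisms between corresponding pieces, which glue (`borelIsomorphic_of_fineShape_eq`).

Now let `E` be the kernel of a Borel map `g : X → W`. The set of `w` with uncountable fiber is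
analytic, so by the perfect set theorem it is countable or has size continuum
(`mk_setOf_mk_fiber_eq_continuum`).

If it is countable, every set `W_m = {w | #(g ⁻¹' {w}) = m}` is Borel. For `m ≤ ℵ₀`, including `0`,
it is coanalytic (`analyticSet_mk_fiber_ne`, resting on Luzin's unicity theorem); the remaining one
is countable; and these countably many sets partition `W`. Taking the `W_m` as parameter spaces
gives a parametrized `F` with the fine shape of `E`. As being parametrized is invariant under Borel
isomorphism, `F` is not isomorphic to `E`.

If it has size continuum, further uncountable classes do not change the fine shape. This freedom
gives two Borel maps whose kernels have the fine shape of `E`, one onto its target space and one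
with non-Borel range (`exists_measurable_fineShape_eq`). If both kernels were isomorphic to `E`, the
induced injection between the targets would make the second range Borel
(`measurableSet_range_of_same_kernel`).

Luzin's theorem is proved with simulations in place of ordinal ranks: `TreeSimulates T u v` plays
the role of "the rank of `u` in `T` is at most that of `v`". A fiber is a singleton iff each level
of its tree has a node strictly above all others in this order. -/

section SmoothRelations

open Set Topology TopologicalSpace MeasureTheory

/-! ### Simulations between nodes of a tree -/

/-- `R` is a simulation on the set `T` of lists (with successors `i :: a` of `a`). -/
def IsTreeSimulation (T : Set (List ℕ)) (R : List ℕ → List ℕ → Prop) : Prop :=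
  ∀ a b, R a b → a ∈ T → b ∈ T ∧ ∀ i, i :: a ∈ T → ∃ j, R (i :: a) (j :: b)

/-- The node `v` of `T` simulates the node `u`. -/
def TreeSimulates (T : Set (List ℕ)) (u v : List ℕ) : Prop :=
  ∃ R : List ℕ → List ℕ → Prop, R u v ∧ IsTreeSimulation T R

/-- There is an infinite branch of `T` through the node `u`. -/
def HasBranchThrough (T : Set (List ℕ)) (u : List ℕ) : Prop :=
  ∃ S : Set (List ℕ), u ∈ S ∧ ∀ a ∈ S, a ∈ T ∧ ∃ k, k :: a ∈ S

section Simulation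

variable {T : Set (List ℕ)} {u v : List ℕ}

/-- A union of simulations is a simulation, so there is a greatest one. -/
theorem isTreeSimulation_treeSimulates : IsTreeSimulation T (TreeSimulates T) := by
  rintro a b ⟨R, hR, hs⟩ ha
  obtain ⟨hb, h⟩ := hs a b hR ha
  refine ⟨hb, fun i hi => ?_⟩
  obtain ⟨j, hj⟩ := h i hi
  exact ⟨j, R, hj, hs⟩

theorem TreeSimulates.of_children
    (h : u ∈ T → v ∈ T ∧ ∀ i, i :: u ∈ T → ∃ j, TreeSimulates T (i :: u) (j :: v)) :
    TreeSimulates T u v := by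
  refine ⟨fun a b => TreeSimulates T a b ∨ (a = u ∧ b = v), Or.inr ⟨rfl, rfl⟩, ?_⟩
  rintro a b (hab | ⟨rfl, rfl⟩) ha
  · obtain ⟨hb, h'⟩ := isTreeSimulation_treeSimulates a b hab ha
    exact ⟨hb, fun i hi => (h' i hi).imp fun j hj => Or.inl hj⟩
  · obtain ⟨hb, h'⟩ := h ha
    exact ⟨hb, fun i hi => (h' i hi).imp fun j hj => Or.inl hj⟩

theorem TreeSimulates.of_notMem (h : u ∉ T) : TreeSimulates T u v :=
  .of_children fun h' => absurd h' h

/-- A node with a branch has infinite rank: any move below `u` is answered by a step along the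
branch. -/
theorem HasBranchThrough.treeSimulates (h : HasBranchThrough T v) : TreeSimulates T u v := by
  obtain ⟨S, hv, hS⟩ := h
  refine ⟨fun _ b => b ∈ S, hv, fun a b hb _ => ⟨(hS b hb).1, fun i _ => (hS b hb).2⟩⟩

theorem HasBranchThrough.of_treeSimulates (h : HasBranchThrough T u) (hs : TreeSimulates T u v) :
    HasBranchThrough T v := by
  obtain ⟨S, hu, hS⟩ := h
  obtain ⟨R, hR, hsim⟩ := hs
  refine ⟨{b | ∃ a ∈ S, R a b}, ⟨u, hu, hR⟩, ?_⟩
  rintro b ⟨a, ha, hab⟩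
  obtain ⟨haT, k, hk⟩ := hS a ha
  obtain ⟨hb, h⟩ := hsim a b hab haT
  obtain ⟨j, hj⟩ := h k (hS _ hk).1
  exact ⟨hb, j, k :: a, hk, hj⟩

/-- Totality of the rank comparison, without ordinals: the reversed negation of `TreeSimulates T` is
itself a simulation. -/
theorem TreeSimulates.of_not (h : ¬ TreeSimulates T v u) : TreeSimulates T u v := by
  refine ⟨fun a b => ¬ TreeSimulates T b a, h, fun a b hab ha => ⟨?_, fun i hi => ?_⟩⟩
  · by_contra hb
    exact hab (.of_notMem hb)
  · by_contra! hj
    exact hab (.of_children fun _ => ⟨ha, fun j _ => ⟨i, hj j⟩⟩)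

/-- The nodes of `T` that dominate all other nodes of their length form a branch of `T`. -/
theorem exists_eq_cons_of_dominating (hT : ∀ k l, k :: l ∈ T → l ∈ T) {s s' : List ℕ}
    (hs' : s' ∈ T) (hlen : s'.length = s.length + 1)
    (h : ∀ t : List ℕ, t.length = s.length → t ≠ s → ¬ TreeSimulates T s t)
    (h' : ∀ t : List ℕ, t.length = s'.length → t ≠ s' → ¬ TreeSimulates T s' t) :
    ∃ k, s' = k :: s := by
  obtain _ | ⟨k, t⟩ := s'
  · simp at hlen
  by_cases hts : t = s
  · exact ⟨k, by rw [hts]⟩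
  exfalso
  -- If `t ≠ s`, each child of `s` differs from `s' = k :: t` and so is simulated by it, by
  -- totality. Thus `t` simulates `s`, against the dominance of `s`.
  refine h t (by simpa using hlen) hts (.of_children fun _ => ⟨hT _ _ hs', fun i hi => ⟨k, ?_⟩⟩)
  refine .of_not (h' _ (by simpa using hlen.symm) ?_)
  rintro ⟨⟩
  exact hts rfl

end Simulation

/-! ### Coding points by sequences -/

/-- A Polish topology can be refined to a Polish topology in which every open set of the former is
a union of clopen sets. -/
theorem exists_polishSpace_clopen_refinement {X : Type*} (t : TopologicalSpace X)
    (ht : @PolishSpace X t) :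
    ∃ t' : TopologicalSpace X, t' ≤ t ∧ @PolishSpace X t' ∧
      ∀ x : X, ∀ U : Set X, IsOpen[t] U → x ∈ U → ∃ V ⊆ U, x ∈ V ∧ IsClosed[t'] V ∧ IsOpen[t'] V := by
  obtain ⟨b, b_count, -, hb⟩ := exists_countable_basis X
  have : Countable b := b_count.to_subtype
  have : ∀ s : b, PolishSpace.IsClopenable (s : Set X) := fun s => (hb.isOpen s.2).isClopenable
  choose m hm hp hc ho using this
  obtain ⟨t', h1, h2, h3⟩ := PolishSpace.exists_polishSpace_forall_le m hm hp
  refine ⟨t', h2, h3, fun x U hU hx => ?_⟩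
  obtain ⟨V, hV, hxV, hVU⟩ :=
    IsTopologicalBasis.exists_subset_of_mem_open (t := t) hb hx hU
  exact ⟨V, hVU, hxV, (hc ⟨V, hV⟩).mono (h1 ⟨V, hV⟩), h1 ⟨V, hV⟩ _ (ho ⟨V, hV⟩)⟩

/-- A Polish topology can be refined to a zero-dimensional Polish topology. -/
theorem exists_polishSpace_zeroDimensional_refinement {X : Type*} (t : TopologicalSpace X)
    (ht : @PolishSpace X t) :
    ∃ t' : TopologicalSpace X, t' ≤ t ∧ @PolishSpace X t' ∧
      ∀ x : X, ∀ U : Set X, IsOpen[t'] U → x ∈ U → ∃ V ⊆ U, x ∈ V ∧ IsClosed[t'] V ∧ IsOpen[t'] V := by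
  choose f hf1 hf2 hf3 using @exists_polishSpace_clopen_refinement X
  let a : ℕ → {t : TopologicalSpace X // @PolishSpace X t} := fun n =>
    Nat.rec ⟨t, ht⟩ (fun _ s => ⟨f s.1 s.2, hf2 s.1 s.2⟩) n
  have ha : ∀ n, (a (n + 1)).1 ≤ (a n).1 := fun n => hf1 _ _
  have hanti : Antitone fun n => (a n).1 := antitone_nat_of_succ_le ha
  -- A neighbourhood in the limit topology is already one at some stage `n`, and stage `n + 1`
  -- supplies the clopen set.
  refine ⟨⨅ n, (a n).1, iInf_le (fun n => (a n).1) 0,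
    PolishSpace.iInf ⟨0, fun n => hanti (Nat.zero_le n)⟩ fun n => (a n).2, ?_⟩
  intro x U hU hx
  have hdir : Directed (· ≥ ·) fun n => (a n).1 := hanti.directed_ge
  have hnhds := @nhds_iInf X ℕ (fun n => (a n).1) x
  have hmem : U ∈ @nhds X (⨅ n, (a n).1) x := @IsOpen.mem_nhds X (⨅ n, (a n).1) x U hU hx
  rw [hnhds, Filter.mem_iInf_of_directed] at hmem
  · obtain ⟨n, hn⟩ := hmem
    obtain ⟨O, hOU, hO, hxO⟩ := (@mem_nhds_iff X (a n).1 x U).1 hn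
    obtain ⟨V, hVO, hxV, hc, ho⟩ := hf3 (a n).1 (a n).2 x O hO hxO
    have hle : (⨅ n, (a n).1) ≤ (a (n + 1)).1 := iInf_le (fun n => (a n).1) (n + 1)
    exact ⟨V, hVO.trans hOU, hxV, IsClosed.mono hc hle, hle _ ho⟩
  · intro i j
    obtain ⟨k, hi, hj⟩ := hdir i j
    exact ⟨k, nhds_mono hi, nhds_mono hj⟩

/-- The points whose code extends (the reverse of) `l`. -/
def codeCylinder {X : Type*} (c : X → ℕ → ℕ) (l : List ℕ) : Set X :=
  {x | PiNat.res (c x) l.length = l}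

theorem codeCylinder_cons_subset {X : Type*} (c : X → ℕ → ℕ) (k : ℕ) (l : List ℕ) :
    codeCylinder c (k :: l) ⊆ codeCylinder c l := by
  intro x hx
  simp only [codeCylinder, mem_ofPred_eq, List.length_cons, PiNat.res_succ, List.cons.injEq] at hx ⊢
  exact hx.2

theorem codeCylinder_cons {X : Type*} (c : X → ℕ → ℕ) (k : ℕ) (l : List ℕ) :
    codeCylinder c (k :: l) = {x | c x l.length = k} ∩ codeCylinder c l := by
  ext x
  simp [codeCylinder, PiNat.res_succ]

/-- For a measurable map `g` on a standard Borel space, points can be coded by sequences of natural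
numbers in such a way that a branch of nodes whose cylinders have `g`-images adherent to `w`
determines a point of the fiber of `w`. -/
theorem exists_code {X W : Type*} [MeasurableSpace X] [StandardBorelSpace X]
    [TopologicalSpace W] [PolishSpace W] [MeasurableSpace W] [BorelSpace W] {g : X → W}
    (hg : Measurable g) :
    ∃ c : X → ℕ → ℕ, Function.Injective c ∧ ∀ (w : W) (a : ℕ → List ℕ),
      (∀ m, ∃ k, a (m + 1) = k :: a m) → (∀ m, w ∈ closure (g '' codeCylinder c (a m))) →
        ∃ x, g x = w ∧ ∀ m, x ∈ codeCylinder c (a m) := by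
  rcases isEmpty_or_nonempty X with hX | hX
  · refine ⟨fun x => hX.elim x, fun x => hX.elim x, fun w a _ h => ?_⟩
    simpa [Set.eq_empty_of_isEmpty] using h 0
  let := upgradeStandardBorel X
  obtain ⟨t0, -, hgc, ht0⟩ := hg.exists_continuous
  obtain ⟨t1, hle, ht1, hclopen⟩ := exists_polishSpace_zeroDimensional_refinement t0 ht0
  have hg1 : @Continuous X W t1 _ g := continuous_le_dom hle hgc
  clear hgc ht0 hle
  let := t1
  let := upgradeIsCompletelyMetrizable X
  have hcover : ∀ n : ℕ, ∃ V : ℕ → Set X, (∀ i, IsClopen (V i)) ∧ (⋃ i, V i) = Set.univ ∧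
      ∀ i, ∀ x ∈ V i, ∀ y ∈ V i, dist x y < 2 * (1 / 2 : ℝ) ^ n := by
    intro n
    have hpos : (0 : ℝ) < (1 / 2 : ℝ) ^ n := by positivity
    choose V hVU hxV hVc hVo using fun x : X =>
      hclopen x (Metric.ball x ((1 / 2 : ℝ) ^ n)) Metric.isOpen_ball (Metric.mem_ball_self hpos)
    obtain ⟨s, hs, hsU⟩ := TopologicalSpace.countable_cover_nhds fun x => (hVo x).mem_nhds (hxV x)
    have hne : s.Nonempty := by
      rw [nonempty_iff_ne_empty]
      rintro rfl
      simp at hsU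
      exact (Set.empty_ne_univ hsU)
    obtain ⟨e, rfl⟩ := hs.exists_eq_range hne
    refine ⟨fun i => V (e i), fun i => ⟨hVc _, hVo _⟩, by simpa using hsU, ?_⟩
    intro i x hx y hy
    have h1 := Metric.mem_ball.1 (hVU _ hx)
    have h2 := Metric.mem_ball.1 (hVU _ hy)
    linarith [dist_triangle_right x y (e i)]
  choose V hV hVu hVd using hcover
  have hex : ∀ n x, ∃ i, x ∈ V n i := fun n x => by
    have : x ∈ ⋃ i, V n i := hVu n ▸ Set.mem_univ x
    simpa using this
  classical
  -- Taking the least index makes the `n`-th cover a partition; its pieces remain closed because the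
  -- `V n i` are clopen.
  let c : X → ℕ → ℕ := fun x n => Nat.find (hex n x)
  have hcV : ∀ x n, x ∈ V n (c x n) := fun x n => Nat.find_spec (hex n x)
  have hdist : ∀ x y n, c x n = c y n → dist x y < 2 * (1 / 2 : ℝ) ^ n := fun x y n h =>
    hVd n _ x (hcV x n) y (h ▸ hcV y n)
  have hlim : Filter.Tendsto (fun n : ℕ => 2 * (1 / 2 : ℝ) ^ n) Filter.atTop (𝓝 0) := by
    simpa using (tendsto_pow_atTop_nhds_zero_of_lt_one (by norm_num : (0 : ℝ) ≤ 1 / 2)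
      (by norm_num)).const_mul 2
  have hpiece : ∀ n k, IsClosed {x | c x n = k} := by
    intro n k
    have : {x | c x n = k} = V n k ∩ ⋂ j ∈ Finset.range k, (V n j)ᶜ := by
      ext x
      simp [c, Nat.find_eq_iff]
    rw [this]
    exact (hV n k).1.inter (isClosed_biInter fun j _ => (hV n j).2.isClosed_compl)
  have hclosed : ∀ l, IsClosed (codeCylinder c l) := by
    intro l
    induction l with
    | nil => simp [codeCylinder]
    | cons k l ih => rw [codeCylinder_cons]; exact (hpiece _ _).inter ih
  refine ⟨c, ?_, ?_⟩
  · intro x y hxy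
    have : ∀ n, dist x y ≤ 2 * (1 / 2 : ℝ) ^ n := fun n => (hdist x y n (congrFun hxy n)).le
    have h0 := ge_of_tendsto' hlim this
    exact dist_le_zero.1 h0
  · intro w a ha hw
    have hlen : ∀ m, (a m).length = (a 0).length + m := by
      intro m
      induction m with
      | zero => rfl
      | succ m ih => obtain ⟨k, hk⟩ := ha m; rw [hk, List.length_cons, ih]; rfl
    have hanti : Antitone fun m => codeCylinder c (a m) := by
      refine antitone_nat_of_succ_le fun m => ?_
      obtain ⟨k, hk⟩ := ha m
      show codeCylinder c (a (m + 1)) ⊆ _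
      rw [hk]
      exact codeCylinder_cons_subset _ _ _
    have hsmall : ∀ m, ∀ x ∈ codeCylinder c (a (m + 1)), ∀ y ∈ codeCylinder c (a (m + 1)),
        dist x y < 2 * (1 / 2 : ℝ) ^ ((a 0).length + m) := by
      intro m x hx y hy
      obtain ⟨k, hk⟩ := ha m
      rw [hk, codeCylinder_cons] at hx hy
      rw [← hlen m]
      exact hdist x y _ (hx.1.trans hy.1.symm)
    have hne : ∀ m, (codeCylinder c (a m)).Nonempty := by
      intro m
      have : (closure (g '' codeCylinder c (a m))).Nonempty := ⟨w, hw m⟩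
      simpa using this
    have hlim' : Filter.Tendsto (fun m : ℕ => 2 * (1 / 2 : ℝ) ^ ((a 0).length + m))
        Filter.atTop (𝓝 0) := hlim.comp (Filter.tendsto_atTop_mono
          (fun m => Nat.le_add_left m _) Filter.tendsto_id)
    choose p hp using fun m => hne (m + 1)
    have hcauchy : CauchySeq p := by
      refine cauchySeq_of_le_tendsto_0 _ (fun n m N hn hm => ?_) hlim'
      exact (hsmall N _ (hanti (by gcongr) (hp n)) _ (hanti (by gcongr) (hp m))).le
    obtain ⟨x, hx⟩ := cauchySeq_tendsto_of_complete hcauchy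
    have hmem : ∀ m, x ∈ codeCylinder c (a m) := by
      intro m
      refine (hclosed _).mem_of_tendsto hx ?_
      filter_upwards [Filter.eventually_ge_atTop m] with n hn
      exact hanti (by omega) (hp n)
    refine ⟨x, ?_, hmem⟩
    by_contra hne'
    obtain ⟨N, hN, hNc, hNw⟩ : ∃ N ∈ 𝓝 (g x), IsClosed N ∧ N ⊆ {w}ᶜ :=
      exists_mem_nhds_isClosed_subset (isOpen_compl_singleton.mem_nhds hne')
    have hpre : g ⁻¹' N ∈ 𝓝 x := hg1.continuousAt.preimage_mem_nhds hN
    obtain ⟨ε, hε, hball⟩ := Metric.mem_nhds_iff.1 hpre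
    obtain ⟨m, hm⟩ := (hlim'.eventually (gt_mem_nhds hε)).exists
    have hsub : g '' codeCylinder c (a (m + 1)) ⊆ N := by
      rintro _ ⟨y, hy, rfl⟩
      exact hball (Metric.mem_ball.2 ((hsmall m y hy x (hmem _)).trans hm))
    exact hNw (closure_minimal hsub hNc (hw (m + 1))) rfl

/-! ### Closure properties of analytic sets, in terms of predicates -/

section AnalyticPredicates

variable {W : Type*} [TopologicalSpace W]

theorem analyticSet_exists {ι : Type*} [Countable ι] {P : ι → W → Prop}
    (h : ∀ i, AnalyticSet {w | P i w}) : AnalyticSet {w | ∃ i, P i w} := by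
  have : {w | ∃ i, P i w} = ⋃ i, {w | P i w} := by ext; simp
  rw [this]
  exact .iUnion h

theorem analyticSet_forall [PolishSpace W] {ι : Type*} [Countable ι] {P : ι → W → Prop}
    (h : ∀ i, AnalyticSet {w | P i w}) : AnalyticSet {w | ∀ i, P i w} := by
  rcases isEmpty_or_nonempty ι with hι | hι
  · simpa using isClosed_univ.analyticSet (α := W)
  have : {w | ∀ i, P i w} = ⋂ i, {w | P i w} := by ext; simp
  rw [this]
  exact .iInter h

theorem analyticSet_or {P Q : W → Prop} (hP : AnalyticSet {w | P w}) (hQ : AnalyticSet {w | Q w}) :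
    AnalyticSet {w | P w ∨ Q w} := by
  have : {w | P w ∨ Q w} = {w | ∃ b : Bool, if b then P w else Q w} := by ext; simp [or_comm]
  rw [this]
  exact analyticSet_exists fun b => by cases b <;> simpa

theorem analyticSet_const_and {p : Prop} {Q : W → Prop} (hQ : p → AnalyticSet {w | Q w}) :
    AnalyticSet {w | p ∧ Q w} := by
  by_cases hp : p
  · simpa [hp] using hQ hp
  · simpa [hp] using analyticSet_empty (α := W)

theorem analyticSet_const_imp [PolishSpace W] {p : Prop} {Q : W → Prop}
    (hQ : p → AnalyticSet {w | Q w}) :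
    AnalyticSet {w | p → Q w} := by
  by_cases hp : p
  · simpa [hp] using hQ hp
  · simpa [hp] using isClosed_univ.analyticSet (α := W)

end AnalyticPredicates

/-! ### Luzin's unicity theorem -/

theorem analyticSet_treeSimulates {W : Type*} [TopologicalSpace W] [PolishSpace W]
    [MeasurableSpace W] [BorelSpace W] {T : W → Set (List ℕ)}
    (hT : ∀ l, MeasurableSet {w | l ∈ T w}) (u v : List ℕ) :
    AnalyticSet {w | TreeSimulates (T w) u v} := by
  -- A simulation is a point of a Cantor space and being one is a Borel condition, so existence is a
  -- projection.
  let S : Set (W × (List ℕ × List ℕ → Bool)) := {p | p.2 (u, v) = true ∧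
    IsTreeSimulation (T p.1) fun a b => p.2 (a, b) = true}
  have hR : ∀ a b, Measurable fun p : W × (List ℕ × List ℕ → Bool) => p.2 (a, b) = true :=
    fun a b => measurableSet_setOfPred.1 <|
      (show Measurable fun p : W × (List ℕ × List ℕ → Bool) => p.2 (a, b) by fun_prop)
        (measurableSet_singleton true)
  have hT' : ∀ l, Measurable fun p : W × (List ℕ × List ℕ → Bool) => l ∈ T p.1 :=
    fun l => measurableSet_setOfPred.1 (measurable_fst (hT l))
  have hS : MeasurableSet S := by
    refine measurableSet_setOfPred.2 ((hR u v).and ?_)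
    exact .forall fun a => .forall fun b => (hR a b).imp <| (hT' a).imp <| (hT' b).and <|
      .forall fun i => (hT' _).imp <| .exists fun j => hR _ _
  have : {w | TreeSimulates (T w) u v} = Prod.fst '' S := by
    ext w
    constructor
    · rintro ⟨R, hR, hs⟩
      classical
      refine ⟨(w, fun q => decide (R q.1 q.2)), ⟨by simpa using hR, ?_⟩, rfl⟩
      simpa using hs
    · rintro ⟨⟨w, R⟩, ⟨h1, h2⟩, rfl⟩
      exact ⟨_, h1, h2⟩
  rw [this]
  exact hS.analyticSet_image measurable_fst

/-- In terms of the tree of nodes whose cylinders are adherent, a fiber has exactly one point iff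
at every level there is a dominating node. -/
theorem existsUnique_iff_dominating {X W : Type*} [TopologicalSpace W] {g : X → W}
    {c : X → ℕ → ℕ} (hc : Function.Injective c) {w : W}
    (h : ∀ a : ℕ → List ℕ,
      (∀ m, ∃ k, a (m + 1) = k :: a m) → (∀ m, w ∈ closure (g '' codeCylinder c (a m))) →
        ∃ x, g x = w ∧ ∀ m, x ∈ codeCylinder c (a m)) :
    (∃! x, g x = w) ↔ ∀ n : ℕ, ∃ s : List ℕ, s.length = n ∧
      w ∈ closure (g '' codeCylinder c s) ∧ ∀ t : List ℕ, t.length = n → t ≠ s →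
        ¬ TreeSimulates {l | w ∈ closure (g '' codeCylinder c l)} s t := by
  set T : Set (List ℕ) := {l | w ∈ closure (g '' codeCylinder c l)} with hTdef
  have hT : ∀ k l, k :: l ∈ T → l ∈ T := fun k l hk =>
    closure_mono (image_mono (codeCylinder_cons_subset c k l)) hk
  have hpt : ∀ x, g x = w → ∀ n, HasBranchThrough T (PiNat.res (c x) n) := by
    intro x hx n
    refine ⟨range (PiNat.res (c x)), ⟨n, rfl⟩, ?_⟩
    rintro _ ⟨m, rfl⟩
    refine ⟨subset_closure ⟨x, by simp [codeCylinder], hx⟩, c x m, m + 1, PiNat.res_succ _ _⟩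
  constructor
  · rintro ⟨x, hx, hux⟩ n
    obtain ⟨S, hS, hST⟩ := hpt x hx n
    refine ⟨PiNat.res (c x) n, PiNat.res_length _ _, (hST _ hS).1, fun t ht hne hsim => hne ?_⟩
    obtain ⟨S', ht', hS'⟩ := (hpt x hx n).of_treeSimulates hsim
    choose k hk using fun a : S' => (hS' a a.2).2
    -- If `t` simulates the node of `x`, it inherits a branch. Following it gives a fiber point
    -- coded through `t`, which must be `x`.
    let a : ℕ → S' := fun m => Nat.rec ⟨t, ht'⟩ (fun _ b => ⟨k b :: b.1, hk b⟩) m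
    obtain ⟨y, hy, hyc⟩ := h (fun m => (a m).1) (fun m => ⟨k (a m), rfl⟩)
      fun m => (hS' _ (a m).2).1
    have := hyc 0
    rw [hux y hy] at this
    rw [← ht]
    exact this.symm
  · intro hdom
    choose s hlen hsT hs using hdom
    obtain ⟨x, hx, hxs⟩ := h s (fun m => exists_eq_cons_of_dominating hT (hsT (m + 1))
      (by rw [hlen, hlen]) (by rw [hlen]; exact hs m) (by rw [hlen]; exact hs (m + 1))) hsT
    have huniq : ∀ y, g y = w → ∀ n, PiNat.res (c y) n = s n := by
      intro y hy n
      by_contra hne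
      exact hs n _ (PiNat.res_length _ _) hne (hpt y hy n).treeSimulates
    refine ⟨x, hx, fun y hy => hc (PiNat.res_injective (funext fun n => ?_))⟩
    rw [huniq y hy n, huniq x hx n]

/-- **Luzin's unicity theorem**: the set of points with exactly one preimage under a Borel map is
coanalytic. -/
theorem analyticSet_compl_existsUnique {X W : Type*} [MeasurableSpace X] [StandardBorelSpace X]
    [TopologicalSpace W] [PolishSpace W] [MeasurableSpace W] [BorelSpace W] {g : X → W}
    (hg : Measurable g) : AnalyticSet {w | ¬ ∃! x, g x = w} := by
  obtain ⟨c, hc, h⟩ := exists_code hg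
  simp only [fun w => existsUnique_iff_dominating hc (h w)]
  -- Negation leaves countable quantifiers over Borel conditions and positive occurrences of
  -- `TreeSimulates`, all analytic.
  push Not
  refine analyticSet_exists fun n => analyticSet_forall fun s => analyticSet_const_imp fun _ =>
    ?_
  simp only [imp_iff_not_or]
  refine analyticSet_or ?_ (analyticSet_exists fun t => analyticSet_const_and fun _ =>
    analyticSet_const_and fun _ => analyticSet_treeSimulates (fun l => ?_) s t)
  · exact isClosed_closure.isOpen_compl.measurableSet.analyticSet
  · exact isClosed_closure.measurableSet

theorem analyticSet_compl_existsUnique_mem {X W : Type*} [MeasurableSpace X]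
    [StandardBorelSpace X] [TopologicalSpace W] [PolishSpace W] [MeasurableSpace W] [BorelSpace W]
    {g : X → W} (hg : Measurable g) {U : Set X} (hU : MeasurableSet U) :
    AnalyticSet {w | ¬ ∃! x, x ∈ U ∧ g x = w} := by
  have := hU.standardBorel
  convert! analyticSet_compl_existsUnique (hg.comp (measurable_subtype_coe (p := (· ∈ U)))) using 3
    with w
  refine not_congr ⟨?_, ?_⟩
  · rintro ⟨x, ⟨hx, hw⟩, hu⟩
    exact ⟨⟨x, hx⟩, hw, fun y hy => Subtype.ext (hu y ⟨y.2, hy⟩)⟩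
  · rintro ⟨x, hw, hu⟩
    exact ⟨x, ⟨x.2, hw⟩, fun y hy => congrArg Subtype.val (hu ⟨y, hy.1⟩ hy.2)⟩

/-! ### Uncountable fibers -/

theorem mk_nat_bool : #(ℕ → Bool) = 𝔠 := by simp

instance uncountable_nat_bool : Uncountable (ℕ → Bool) := by
  rw [← Cardinal.aleph0_lt_mk_iff, mk_nat_bool]
  exact aleph0_lt_continuum

/-- A form of the Mazurkiewicz–Sierpiński theorem: the set of points with uncountable fiber is the
image of a standard Borel space under a measurable map. -/
theorem exists_measurableSet_image_eq_not_countable {X W : Type*} [MeasurableSpace X]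
    [StandardBorelSpace X] [TopologicalSpace W] [PolishSpace W] [MeasurableSpace W] [BorelSpace W]
    {g : X → W} (hg : Measurable g) :
    ∃ S : Set (ℕ → X), MeasurableSet S ∧
      (fun x => g (x 0)) '' S = {w | ¬ (g ⁻¹' {w}).Countable} := by
  let := upgradeStandardBorel X
  -- Refining the topology makes fibers closed without changing the Borel sets. A closed fiber is
  -- uncountable iff it contains a sequence whose range has no isolated points; `S` collects such
  -- sequences.
  obtain ⟨t, hle, hgc, ht⟩ := hg.exists_continuous
  have hborel : @BorelSpace X t _ := ⟨by
    rw [eq_borel_upgradeStandardBorel X, borel_eq_borel_of_le ht _ hle]; infer_instance⟩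
  clear hle
  let := t
  let := upgradeIsCompletelyMetrizable X
  let S : Set (ℕ → X) := {x | (∀ n, g (x n) = g (x 0)) ∧ ∀ n, ∀ U : countableBasis X,
    x n ∈ (U : Set X) → ∃ j, x j ∈ (U : Set X) ∧ ¬ x j = x n}
  have hU : ∀ (U : countableBasis X) n, Measurable fun x : ℕ → X => x n ∈ (U : Set X) :=
    fun U n => measurableSet_setOfPred.1 <|
      (measurable_pi_apply n) (isOpen_of_mem_countableBasis U.2).measurableSet
  have hS : MeasurableSet S := by
    refine measurableSet_setOfPred.2 (.and (.forall fun n => ?_) (.forall fun n => .forall fun U =>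
      (hU U n).imp (.exists fun j => (hU U j).and (.not ?_))))
    · exact measurableSet_setOfPred.1 (measurableSet_eq_fun (by fun_prop) (by fun_prop))
    · exact measurableSet_setOfPred.1 (measurableSet_eq_fun (by fun_prop) (by fun_prop))
  have hfib : ∀ w, IsClosed (g ⁻¹' {w}) := fun w => isClosed_singleton.preimage hgc
  refine ⟨S, hS, Subset.antisymm ?_ fun w hw => ?_⟩
  · rintro _ ⟨x, ⟨hx, hx'⟩, rfl⟩ hcount
    have hpre : Preperfect (range x) := by
      rw [preperfect_iff_nhds]
      rintro _ ⟨n, rfl⟩ V hV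
      obtain ⟨U, hUb, hxU, hUV⟩ := (isBasis_countableBasis X).mem_nhds_iff.1 hV
      obtain ⟨j, hj, hne⟩ := hx' n ⟨U, hUb⟩ hxU
      exact ⟨x j, ⟨hUV hj, j, rfl⟩, hne⟩
    obtain ⟨f, hf, -, hinj⟩ := hpre.perfect_closure.exists_nat_bool_injection
      ((range_nonempty x).mono subset_closure)
    have hsub : range f ⊆ g ⁻¹' {g (x 0)} := hf.trans <| closure_minimal
      (by rintro _ ⟨n, rfl⟩; exact hx n) (hfib _)
    exact not_countable_univ <| MapsTo.countable_of_injOn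
      (fun x _ => hsub (mem_range_self x)) hinj.injOn hcount
  · obtain ⟨D, hD, hDne, hDsub⟩ := exists_perfect_nonempty_of_isClosed_of_not_countable (hfib w) hw
    have : Nonempty D := hDne.to_subtype
    refine ⟨fun n => denseSeq D n, ⟨fun n => ?_, fun n U hn => ?_⟩, hDsub (denseSeq D 0).2⟩
    · exact (hDsub (denseSeq D n).2).trans (hDsub (denseSeq D 0).2).symm
    · obtain ⟨y, ⟨hyU, hyD⟩, hne⟩ := preperfect_iff_nhds.1 hD.acc _ (denseSeq D n).2 U
        ((isOpen_of_mem_countableBasis U.2).mem_nhds hn)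
      have hopen : IsOpen {z : D | (z : X) ∈ (U : Set X) \ {(denseSeq D n : X)}} :=
        ((isOpen_of_mem_countableBasis U.2).sdiff isClosed_singleton).preimage
          continuous_subtype_val
      obtain ⟨j, hj⟩ := (denseRange_denseSeq D).exists_mem_open hopen ⟨⟨y, hyD⟩, hyU, hne⟩
      exact ⟨j, hj.1, hj.2⟩

theorem analyticSet_not_countable_fiber {X W : Type*} [MeasurableSpace X]
    [StandardBorelSpace X] [TopologicalSpace W] [PolishSpace W] [MeasurableSpace W] [BorelSpace W]
    {g : X → W} (hg : Measurable g) : AnalyticSet {w | ¬ (g ⁻¹' {w}).Countable} := by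
  obtain ⟨S, hS, h⟩ := exists_measurableSet_image_eq_not_countable hg
  rw [← h]
  exact hS.analyticSet_image (by fun_prop)

/-! ### The perfect set theorem for images of Borel maps -/

/-- Discarding the countably many basic open sets with countable trace on `s` removes only countably
many points of `s`; those left are condensation points. -/
theorem exists_nhds_not_countable {W : Type*} [TopologicalSpace W] [SecondCountableTopology W]
    {s : Set W} (hs : ¬ s.Countable) :
    ∃ w₀ w₁, w₀ ≠ w₁ ∧ (∀ N ∈ 𝓝 w₀, ¬ (s ∩ N).Countable) ∧ ∀ N ∈ 𝓝 w₁, ¬ (s ∩ N).Countable := by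
  let B : Set (Set W) := {U ∈ countableBasis W | (s ∩ U).Countable}
  have hB : (⋃ U ∈ B, s ∩ U).Countable :=
    ((countable_countableBasis W).mono (sep_subset _ _)).biUnion fun U hU => hU.2
  have hne : ¬ (s \ ⋃ U ∈ B, s ∩ U).Subsingleton := fun h =>
    hs ((h.countable.union hB).mono (by rw [sdiff_union_self]; exact subset_union_left))
  rw [not_subsingleton_iff] at hne
  have key : ∀ w ∈ s \ ⋃ U ∈ B, s ∩ U, ∀ N ∈ 𝓝 w, ¬ (s ∩ N).Countable := by
    rintro w ⟨hws, hw⟩ N hN hc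
    obtain ⟨U, hU, hwU, hUN⟩ := (isBasis_countableBasis W).mem_nhds_iff.1 hN
    exact hw (mem_biUnion (x := U) ⟨hU, hc.mono (inter_subset_inter_right s hUN)⟩ ⟨hws, hwU⟩)
  obtain ⟨w₀, h₀, w₁, h₁, hne⟩ := hne
  exact ⟨w₀, w₁, hne, key w₀ h₀, key w₁ h₁⟩

open scoped ENNReal in
theorem exists_small_subset_not_countable_image {X W : Type*} [PseudoEMetricSpace X]
    [SecondCountableTopology X] (g : X → W) {C : Set X} (hC : IsClosed C)
    (h : ¬ (g '' C).Countable) {ε : ℝ≥0∞} (hε : 0 < ε) :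
    ∃ D ⊆ C, IsClosed D ∧ ¬ (g '' D).Countable ∧ Metric.ediam D ≤ ε := by
  by_contra! hD
  obtain ⟨s, hs, hsU⟩ := TopologicalSpace.countable_cover_nhds fun x : X =>
    Metric.closedEBall_mem_nhds x (ENNReal.half_pos hε.ne')
  refine h (((hs.biUnion fun x _ => ?_) : (⋃ x ∈ s,
    g '' (C ∩ Metric.closedEBall x (ε / 2))).Countable).mono ?_)
  · by_contra hx
    refine (hD _ inter_subset_left (hC.inter Metric.isClosed_closedEBall) hx).not_ge ?_
    refine (Metric.ediam_mono inter_subset_right).trans (Metric.ediam_closedEBall_le.trans ?_)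
    rw [ENNReal.mul_div_cancel two_ne_zero ENNReal.ofNat_ne_top]
  · rintro _ ⟨x, hx, rfl⟩
    have : x ∈ ⋃ y ∈ s, Metric.closedEBall y (ε / 2) := hsU ▸ mem_univ x
    simp only [mem_iUnion] at this ⊢
    obtain ⟨y, hy, hxy⟩ := this
    exact ⟨y, hy, x, ⟨hx, hxy⟩, rfl⟩

open scoped ENNReal in
-- The splitting step of the Cantor scheme: separate two condensation points of `g '' C` by disjoint
-- closed neighbourhoods, pull these back, and shrink.
theorem exists_split_not_countable_image {X W : Type*} [PseudoEMetricSpace X]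
    [SecondCountableTopology X] [TopologicalSpace W] [SecondCountableTopology W] [T25Space W]
    {g : X → W} (hg : Continuous g) {C : Set X} (hC : IsClosed C)
    (h : ¬ (g '' C).Countable) {ε : ℝ≥0∞} (hε : 0 < ε) :
    ∃ C₀ C₁ : Set X, (IsClosed C₀ ∧ ¬ (g '' C₀).Countable ∧ C₀ ⊆ C ∧ Metric.ediam C₀ ≤ ε) ∧
      (IsClosed C₁ ∧ ¬ (g '' C₁).Countable ∧ C₁ ⊆ C ∧ Metric.ediam C₁ ≤ ε) ∧
        Disjoint (g '' C₀) (g '' C₁) := by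
  obtain ⟨w₀, w₁, hne, h₀, h₁⟩ := exists_nhds_not_countable h
  obtain ⟨N₀, hN₀, N₁, hN₁, hdisj⟩ := exists_nhds_disjoint_closure hne
  have key : ∀ N : Set W, IsClosed N → ¬ (g '' C ∩ N).Countable →
      ∃ D, (IsClosed D ∧ ¬ (g '' D).Countable ∧ D ⊆ C ∧ Metric.ediam D ≤ ε) ∧ g '' D ⊆ N := by
    intro N hN hc
    rw [← image_inter_preimage] at hc
    obtain ⟨D, hD, hDc, hDu, hDd⟩ :=
      exists_small_subset_not_countable_image g (hC.inter (hN.preimage hg)) hc hε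
    exact ⟨D, ⟨hDc, hDu, hD.trans inter_subset_left, hDd⟩,
      image_subset_iff.2 (hD.trans inter_subset_right)⟩
  obtain ⟨C₀, hC₀, hsub₀⟩ := key _ isClosed_closure (h₀ _ (Filter.mem_of_superset hN₀ subset_closure))
  obtain ⟨C₁, hC₁, hsub₁⟩ := key _ isClosed_closure (h₁ _ (Filter.mem_of_superset hN₁ subset_closure))
  exact ⟨C₀, C₁, hC₀, hC₁, hdisj.mono hsub₀ hsub₁⟩

open CantorScheme in
/-- A continuous image of a Polish space is countable or contains a copy of the Cantor space. -/
theorem exists_nat_bool_injection_range_of_continuous {X W : Type*} [TopologicalSpace X]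
    [PolishSpace X] [TopologicalSpace W] [SecondCountableTopology W] [T25Space W]
    {g : X → W} (hg : Continuous g) (h : ¬ (range g).Countable) :
    ∃ f : (ℕ → Bool) → W, Function.Injective f ∧ range f ⊆ range g := by
  let := upgradeIsCompletelyMetrizable X
  obtain ⟨u, -, upos', hu⟩ := exists_seq_strictAnti_tendsto' (zero_lt_one' ENNReal)
  have upos := fun n => (upos' n).1
  choose C0 C1 h0 h1 hdisj using fun (C : {C : Set X // IsClosed C ∧ ¬ (g '' C).Countable}) (n : ℕ) =>
    exists_split_not_countable_image hg C.2.1 C.2.2 (upos n)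
  let DP : List Bool → {C : Set X // IsClosed C ∧ ¬ (g '' C).Countable} := fun l => l.rec
    ⟨univ, isClosed_univ, by rwa [image_univ]⟩
    fun a l C => match a with
      | false => ⟨C0 C l.length, (h0 _ _).1, (h0 _ _).2.1⟩
      | true => ⟨C1 C l.length, (h1 _ _).1, (h1 _ _).2.1⟩
  let D : List Bool → Set X := fun l => (DP l).1
  have hne : ∀ l, (D l).Nonempty := by
    intro l
    rw [nonempty_iff_ne_empty]
    intro h
    apply (DP l).2.2
    rw [show (DP l).1 = ∅ from h, image_empty]
    exact countable_empty
  have hanti : ClosureAntitone D := by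
    refine Antitone.closureAntitone ?_ fun l => (DP l).2.1
    rintro l (_ | _)
    · exact (h0 _ _).2.2.1
    · exact (h1 _ _).2.2.1
  have hdiam : VanishingDiam D := by
    intro x
    -- The root is `univ`, with no diameter bound; level `n + 1` is bounded by `u n`.
    rw [← Filter.tendsto_add_atTop_iff_nat 1]
    refine tendsto_of_tendsto_of_tendsto_of_le_of_le tendsto_const_nhds hu (fun _ => zero_le)
      fun n => ?_
    have : ∀ a, Metric.ediam (D (a :: PiNat.res x n)) ≤ u n := by
      rintro (_ | _)
      · exact (h0 (DP (PiNat.res x n)) (PiNat.res x n).length).2.2.2.trans_eq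
          (by rw [PiNat.res_length])
      · exact (h1 (DP (PiNat.res x n)) (PiNat.res x n).length).2.2.2.trans_eq
          (by rw [PiNat.res_length])
    exact this (x n)
  have hdisj' : CantorScheme.Disjoint fun l => g '' D l := by
    rintro l (_ | _) (_ | _) hab <;> try contradiction
    · exact hdisj _ _
    · exact (hdisj _ _).symm
  have hdom : ∀ x : ℕ → Bool, x ∈ (inducedMap fun l => g '' D l).1 := fun x => by
    have hx : x ∈ (inducedMap D).1 := by
      rw [hanti.map_of_vanishingDiam hdiam hne]
      apply mem_univ
    exact ⟨g ((inducedMap D).2 ⟨x, hx⟩), mem_iInter.2 fun n => ⟨_, map_mem ⟨x, hx⟩ n, rfl⟩⟩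
  refine ⟨fun x => (inducedMap fun l => g '' D l).2 ⟨x, hdom x⟩, fun x y hxy => ?_, ?_⟩
  · simpa only [← Subtype.val_inj] using hdisj'.map_injective hxy
  · rintro _ ⟨x, rfl⟩
    exact image_subset_range _ _ (map_mem (A := fun l => g '' D l) ⟨x, hdom x⟩ 0)

theorem exists_nat_bool_injection_range_of_measurable {X W : Type*} [MeasurableSpace X]
    [StandardBorelSpace X] [MeasurableSpace W] [StandardBorelSpace W]
    {g : X → W} (hg : Measurable g) (h : ¬ (range g).Countable) :
    ∃ f : (ℕ → Bool) → W, Function.Injective f ∧ range f ⊆ range g := by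
  let := upgradeStandardBorel X
  let := upgradeStandardBorel W
  obtain ⟨t, -, hgc, ht⟩ := hg.exists_continuous
  exact @exists_nat_bool_injection_range_of_continuous X W t ht _ _ _ g hgc h

/-! ### Points with a prescribed number of preimages -/

theorem natCast_le_mk_iff {X : Type u} {C : Set X} {n : ℕ} :
    (n : Cardinal.{u}) ≤ #C ↔ ∃ x : Fin n → X, Function.Injective x ∧ ∀ i, x i ∈ C := by
  have h1 : (n : Cardinal.{u}) ≤ #C ↔ lift.{u} #(Fin n) ≤ lift.{0} #C := by simp
  rw [h1, lift_mk_le']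
  constructor
  · rintro ⟨e⟩
    exact ⟨fun i => e i, fun i j h => e.injective (Subtype.ext h), fun i => (e i).2⟩
  · rintro ⟨x, hx, hC⟩
    exact ⟨⟨fun i => ⟨x i, hC i⟩, fun i j h => hx (congrArg Subtype.val h)⟩⟩

theorem analyticSet_natCast_le_mk_fiber {X : Type u} {W : Type*} [MeasurableSpace X]
    [StandardBorelSpace X] [TopologicalSpace W] [PolishSpace W] [MeasurableSpace W] [BorelSpace W]
    {g : X → W} (hg : Measurable g) (n : ℕ) :
    AnalyticSet {w | ((n + 1 : ℕ) : Cardinal.{u}) ≤ #(g ⁻¹' {w})} := by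
  -- With `n + 1` points there is always a point `x 0` to carry the common value of `g`.
  let S : Set (Fin (n + 1) → X) := {x | (∀ i j, x i = x j → i = j) ∧ ∀ i, g (x i) = g (x 0)}
  have hS : MeasurableSet S := by
    refine measurableSet_setOfPred.2 (.and (.forall fun i => .forall fun j => .imp ?_ ?_)
      (.forall fun i => ?_))
    · exact measurableSet_setOfPred.1 (measurableSet_eq_fun (by fun_prop) (by fun_prop))
    · exact measurable_const
    · exact measurableSet_setOfPred.1 (measurableSet_eq_fun (by fun_prop) (by fun_prop))
  have : {w | ((n + 1 : ℕ) : Cardinal.{u}) ≤ #(g ⁻¹' {w})} = (fun x => g (x 0)) '' S := by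
    ext w
    rw [mem_ofPred_eq, natCast_le_mk_iff]
    constructor
    · rintro ⟨x, hx, hw⟩
      exact ⟨x, ⟨fun i j h => hx h, fun i => (hw i).trans (hw 0).symm⟩, hw 0⟩
    · rintro ⟨x, ⟨hx, hx'⟩, rfl⟩
      exact ⟨x, fun i j h => hx i j h, hx'⟩
  rw [this]
  exact hS.analyticSet_image (by fun_prop)

/-- A countable closed set with at least `n` points in a Polish space has at least `n` isolated
points. -/
theorem exists_isolated_of_natCast_le_mk {X : Type u} [TopologicalSpace X] [PolishSpace X]
    {C : Set X} (hC : IsClosed C) (hcount : C.Countable) {n : ℕ} (hn : (n : Cardinal.{u}) ≤ #C) :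
    ∃ x : Fin n → X, Function.Injective x ∧ ∀ i, ∃ U, IsOpen U ∧ U ∩ C = {x i} := by
  have := hC.polishSpace
  have := hcount.to_subtype
  let D : Set C := {x | IsOpen {x}}
  -- Baire category: the complement of a non-isolated point is open and dense, and there are only
  -- countably many such points.
  have hD : Dense D := by
    have : D = ⋂ x ∈ Dᶜ, {x}ᶜ := by
      ext y
      simp only [mem_iInter, mem_compl_iff, mem_singleton_iff]
      exact ⟨fun hy x hx h => hx (h ▸ hy), fun h => by_contra fun hy => h y hy rfl⟩
    rw [this]
    refine dense_biInter_of_isOpen (fun x _ => isOpen_compl_singleton) (to_countable _) ?_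
    intro x hx
    exact dense_compl_singleton_iff_not_open.2 hx
  have hle : (n : Cardinal.{u}) ≤ #D := by
    -- If `D` is finite it is closed, hence all of `C`; if it is infinite it has more than enough
    -- points.
    rcases D.finite_or_infinite with hfin | hinf
    · rwa [hfin.isClosed.closure_eq.symm.trans hD.closure_eq, mk_univ]
    · have := hinf.to_subtype
      exact natCast_lt_aleph0.le.trans (aleph0_le_mk D)
  obtain ⟨x, hx, hxD⟩ := natCast_le_mk_iff.1 hle
  refine ⟨fun i => x i, fun i j h => hx (Subtype.ext h), fun i => ?_⟩
  obtain ⟨U, hU, hUx⟩ := isOpen_induced_iff.1 (hxD i)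
  refine ⟨U, hU, ?_⟩
  rw [inter_comm, ← Subtype.image_preimage_coe, hUx, image_singleton]

/-- A countable closed set has at least `n` points iff there are `n` disjoint basic open sets
containing exactly one point of it each. -/
theorem natCast_le_mk_iff_existsUnique {X : Type u} [TopologicalSpace X] [PolishSpace X]
    {C : Set X} (hC : IsClosed C) (hcount : C.Countable) {n : ℕ} :
    (n : Cardinal.{u}) ≤ #C ↔ ∃ U : Fin n → countableBasis X,
      Pairwise (fun i j => Disjoint (U i : Set X) (U j)) ∧ ∀ i, ∃! x, x ∈ (U i : Set X) ∧ x ∈ C := by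
  constructor
  · intro h
    obtain ⟨x, hx, hU⟩ := exists_isolated_of_natCast_le_mk hC hcount h
    choose U hUo hU using hU
    obtain ⟨V, hV, hdisj⟩ := (finite_range x).t2_separation
    have hmem : ∀ i, x i ∈ U i ∧ x i ∈ C := fun i => by
      rw [← mem_inter_iff, hU i]; rfl
    choose B hB hxB hBUV using fun i => (isBasis_countableBasis X).exists_subset_of_mem_open
      (⟨(hmem i).1, (hV (x i)).1⟩ : x i ∈ U i ∩ V (x i)) ((hUo i).inter (hV (x i)).2)
    refine ⟨fun i => ⟨B i, hB i⟩, fun i j hij => ?_, fun i => ⟨x i, ⟨hxB i, (hmem i).2⟩, ?_⟩⟩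
    · exact (hdisj (mem_range_self i) (mem_range_self j) (hx.ne hij)).mono
        ((hBUV i).trans inter_subset_right) ((hBUV j).trans inter_subset_right)
    · rintro y ⟨hy, hyC⟩
      have : y ∈ U i ∩ C := ⟨(hBUV i hy).1, hyC⟩
      rwa [hU i] at this
  · rintro ⟨U, hdisj, hU⟩
    choose x hx _ using hU
    refine natCast_le_mk_iff.2 ⟨x, fun i j hij => ?_, fun i => (hx i).2⟩
    by_contra hne
    exact disjoint_left.1 (hdisj hne) (hx i).1 (hij ▸ (hx j).1)

/-- For `m` countable and nonzero, the set of points with exactly `m` preimages under a Borel map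
is coanalytic. -/
theorem analyticSet_mk_fiber_ne {X : Type u} {W : Type*} [MeasurableSpace X]
    [StandardBorelSpace X] [TopologicalSpace W] [PolishSpace W] [MeasurableSpace W] [BorelSpace W]
    {g : X → W} (hg : Measurable g) {m : Cardinal.{u}} (hm : m ≤ ℵ₀) :
    AnalyticSet {w | #(g ⁻¹' {w}) ≠ m} := by
  let := upgradeStandardBorel X
  obtain ⟨t, hle, hgc, ht⟩ := hg.exists_continuous
  have hborel : @BorelSpace X t _ := ⟨by
    rw [eq_borel_upgradeStandardBorel X, borel_eq_borel_of_le ht _ hle]; infer_instance⟩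
  clear hle
  let := t
  let I : ℕ → W → Prop := fun n w => ∃ U : Fin n → countableBasis X,
      Pairwise (fun i j => Disjoint (U i : Set X) (U j)) ∧
        ∀ i, ∃! x, x ∈ (U i : Set X) ∧ g x = w
  have hI : ∀ n w, (g ⁻¹' {w}).Countable → (I n w ↔ (n : Cardinal.{u}) ≤ #(g ⁻¹' {w})) :=
    fun n w hw => (natCast_le_mk_iff_existsUnique (isClosed_singleton.preimage hgc) hw).symm
  have hIa : ∀ n, AnalyticSet {w | ¬ I n w} := by
    intro n
    simp only [I, not_exists, not_and, not_forall]
    exact analyticSet_forall fun U => analyticSet_const_imp fun _ => analyticSet_exists fun i =>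
      analyticSet_compl_existsUnique_mem hg (isOpen_of_mem_countableBasis (U i).2).measurableSet
  have hunc := analyticSet_not_countable_fiber hg
  rcases hm.lt_or_eq with hlt | rfl
  · obtain ⟨n, rfl⟩ := lt_aleph0.1 hlt
    -- Having at least `n` points is a priori an analytic condition, but on countable fibers `I n`
    -- rewrites it through unicity, so its negation is analytic too.
    have : {w | #(g ⁻¹' {w}) ≠ n} = {w | ¬ (g ⁻¹' {w}).Countable ∨ ¬ I n w ∨
        ((n + 1 : ℕ) : Cardinal.{u}) ≤ #(g ⁻¹' {w})} := by
      ext w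
      simp only [mem_ofPred_eq]
      by_cases hw : (g ⁻¹' {w}).Countable
      · simp only [hw, hI n w hw, not_true, false_or, Nat.cast_add, Nat.cast_one, not_le,
          ← Cardinal.succ_natCast, Order.succ_le_iff]
        exact ne_iff_lt_or_gt
      · simp only [hw, not_false_eq_true, true_or, iff_true]
        rintro h
        exact hw (le_aleph0_iff_set_countable.1 (h ▸ hm))
    rw [this]
    exact analyticSet_or hunc (analyticSet_or (hIa n) (analyticSet_natCast_le_mk_fiber hg n))
  · have : {w | #(g ⁻¹' {w}) ≠ ℵ₀} = {w | ¬ (g ⁻¹' {w}).Countable ∨ ∃ n, ¬ I n w} := by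
      ext w
      simp only [mem_ofPred_eq]
      by_cases hw : (g ⁻¹' {w}).Countable
      · simp only [hw, hI _ w hw, not_true, false_or]
        rw [← not_forall, not_iff_not, ← aleph0_le, (le_aleph0_iff_set_countable.2 hw).ge_iff_eq',
          eq_comm]
      · simp only [hw, not_false_eq_true, true_or, iff_true]
        rintro h
        exact hw (le_aleph0_iff_set_countable.1 (h ▸ hm))
    rw [this]
    exact analyticSet_or hunc (analyticSet_exists hIa)

/-! ### Countable disjoint unions of standard Borel spaces -/

theorem measurableSet_sigma_iff' {ι : Type*} {X : ι → Type*} [∀ i, MeasurableSpace (X i)]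
    {s : Set (Σ i, X i)} : MeasurableSet s ↔ ∀ i, MeasurableSet (Sigma.mk i ⁻¹' s) := by
  rw [Sigma.instMeasurableSpace, MeasurableSpace.measurableSet_iInf]
  rfl

theorem measurable_sigma_iff {ι : Type*} {X : ι → Type*} [∀ i, MeasurableSpace (X i)] {Y : Type*}
    [MeasurableSpace Y] {f : (Σ i, X i) → Y} : Measurable f ↔ ∀ i, Measurable fun x => f ⟨i, x⟩ :=
  ⟨fun h i _ hs => measurableSet_sigma_iff'.1 (h hs) i,
    fun h _ hs => measurableSet_sigma_iff'.2 fun i => h i hs⟩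

theorem measurable_sigma_mk {ι : Type*} {X : ι → Type*} [∀ i, MeasurableSpace (X i)] (i : ι) :
    Measurable (Sigma.mk i : X i → Σ i, X i) :=
  measurable_sigma_iff.1 measurable_id i

instance borelSpace_sigma {ι : Type*} [Countable ι] {X : ι → Type*} [∀ i, MeasurableSpace (X i)]
    [∀ i, TopologicalSpace (X i)] [∀ i, BorelSpace (X i)] : BorelSpace (Σ i, X i) := by
  refine ⟨le_antisymm (fun s hs => ?_) (MeasurableSpace.generateFrom_le fun s hs => ?_)⟩
  · rw [measurableSet_sigma_iff'] at hs
    have : s = ⋃ i, Sigma.mk i '' (Sigma.mk i ⁻¹' s) := by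
      refine Subset.antisymm (fun p hp => mem_iUnion.2 ⟨p.1, p.2, hp, rfl⟩) ?_
      exact iUnion_subset fun i => image_preimage_subset _ _
    rw [this]
    borelize (Σ i, X i)
    exact .iUnion fun i => IsOpenEmbedding.sigmaMk.measurableEmbedding.measurableSet_image' (hs i)
  · exact measurableSet_sigma_iff'.2 fun i => (isOpen_sigma_iff.1 hs i).measurableSet

instance standardBorelSpace_sigma {ι : Type*} [Countable ι] {X : ι → Type*}
    [∀ i, MeasurableSpace (X i)] [∀ i, StandardBorelSpace (X i)] :
    StandardBorelSpace (Σ i, X i) := by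
  let := fun i => upgradeStandardBorel (X i)
  infer_instance

instance borelSpace_sum {X Y : Type*} [MeasurableSpace X] [TopologicalSpace X] [BorelSpace X]
    [MeasurableSpace Y] [TopologicalSpace Y] [BorelSpace Y] : BorelSpace (X ⊕ Y) := by
  refine ⟨le_antisymm (fun s hs => ?_) (MeasurableSpace.generateFrom_le fun s hs => ?_)⟩
  · rw [measurableSet_sum_iff] at hs
    rw [← image_preimage_inl_union_image_preimage_inr s]
    borelize (X ⊕ Y)
    exact (IsOpenEmbedding.inl.measurableEmbedding.measurableSet_image' hs.1).union
      (IsOpenEmbedding.inr.measurableEmbedding.measurableSet_image' hs.2)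
  · have hs := isOpen_sum_iff.1 hs
    exact measurableSet_sum_iff.2 ⟨hs.1.measurableSet, hs.2.measurableSet⟩

instance standardBorelSpace_sum {X Y : Type*} [MeasurableSpace X] [StandardBorelSpace X]
    [MeasurableSpace Y] [StandardBorelSpace Y] : StandardBorelSpace (X ⊕ Y) := by
  let := upgradeStandardBorel X
  let := upgradeStandardBorel Y
  infer_instance

instance countable_CPlus : Countable ↥CPlus.{u} := by
  have : CPlus.{u} ⊆ range (fun n : ℕ => (n : Cardinal.{u})) ∪ {ℵ₀, 𝔠} := by
    rintro m ⟨-, hm | rfl⟩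
    · rcases hm.lt_or_eq with hlt | rfl
      · obtain ⟨n, rfl⟩ := lt_aleph0.1 hlt
        exact Or.inl ⟨n, rfl⟩
      · simp
    · simp
  exact (((countable_range _).union (to_countable _)).mono this).to_subtype

/-! ### Cardinalities of standard Borel spaces -/

theorem mk_standardBorel_of_not_countable {X : Type u} [MeasurableSpace X] [StandardBorelSpace X]
    (h : ¬ Countable X) : #X = 𝔠 := by
  have := (lift_mk_eq'.2 ⟨(PolishSpace.measurableEquivNatBoolOfNotCountable h).toEquiv⟩ :
    lift.{0} #X = lift.{u} #(ℕ → Bool))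
  rwa [mk_nat_bool, lift_continuum, Cardinal.lift_id'] at this

theorem mk_standardBorel_le {X : Type u} [MeasurableSpace X] [StandardBorelSpace X] : #X ≤ 𝔠 := by
  by_cases h : Countable X
  · exact (mk_le_aleph0_iff.2 h).trans aleph0_le_continuum
  · exact (mk_standardBorel_of_not_countable h).le

/-- There is a standard Borel space of every cardinality in `𝒞⁺`. -/
theorem exists_standardBorelSpace_mk (m : ↥CPlus.{u}) :
    ∃ (Y : Type u) (_ : MeasurableSpace Y), StandardBorelSpace Y ∧ #Y = m := by
  obtain ⟨m, -, hm | rfl⟩ := m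
  · induction m using Cardinal.inductionOn with
    | _ Y =>
    have : Countable Y := mk_le_aleph0_iff.1 hm
    let : MeasurableSpace Y := ⊤
    exact ⟨Y, ⊤, inferInstance, rfl⟩
  · have : PolishSpace (ULift.{u} ℝ) := IsClosedEmbedding.uliftDown.polishSpace
    exact ⟨ULift.{u} ℝ, inferInstance, inferInstance, by simp [mk_real]⟩

/-! ### Fine shapes -/

theorem nonempty_fiber_equiv_classes {X : Type u} {W : Type*} {E : Setoid X} {g : X → W}
    (hg : ∀ x y, E.r x y ↔ g x = g y) (m : ↥CPlus.{u}) :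
    Nonempty ({w : W | #(g ⁻¹' {w}) = (m : Cardinal.{u})} ≃
      {C : Set X // C ∈ E.classes ∧ #C = (m : Cardinal.{u})}) := by
  have hm : (m : Cardinal.{u}) ≠ 0 := m.2.1
  have hcls : ∀ C : Set X, C ∈ E.classes ↔ ∃ x, C = g ⁻¹' {g x} := by
    intro C
    refine exists_congr fun x => ?_
    have : {y | E y x} = g ⁻¹' {g x} := Set.ext fun y => hg y x
    rw [this]
  have hne : ∀ w, #(g ⁻¹' {w}) = (m : Cardinal.{u}) → ∃ x, g x = w := by
    intro w hw
    rw [← hw, mk_ne_zero_iff] at hm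
    exact hm.elim fun x => ⟨x, x.2⟩
  refine ⟨Equiv.ofBijective (fun w => ⟨g ⁻¹' {w.1}, ?_, w.2⟩) ⟨?_, ?_⟩⟩
  · obtain ⟨x, hx⟩ := hne w.1 w.2
    exact (hcls _).2 ⟨x, by rw [hx]⟩
  · rintro ⟨w, hw⟩ ⟨w', hw'⟩ h
    obtain ⟨x, rfl⟩ := hne w hw
    have hx : x ∈ g ⁻¹' {w'} := by
      have h' : g ⁻¹' {g x} = g ⁻¹' {w'} := congrArg Subtype.val h
      rw [← h']; rfl
    exact Subtype.ext hx
  · rintro ⟨C, hC, hCm⟩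
    obtain ⟨x, rfl⟩ := (hcls C).1 hC
    exact ⟨⟨g x, hCm⟩, rfl⟩

theorem fineShape_eq_mk_fiber {X W : Type u} {E : Setoid X} {g : X → W}
    (hg : ∀ x y, E.r x y ↔ g x = g y) (m : ↥CPlus.{u}) :
    fineShape E m = #{w : W | #(g ⁻¹' {w}) = (m : Cardinal.{u})} :=
  (nonempty_fiber_equiv_classes hg m).elim fun e => (mk_congr e).symm

theorem BorelIsomorphic.fineShape_eq {X Y : Type u} [MeasurableSpace X] [MeasurableSpace Y]
    {E : Setoid X} {F : Setoid Y} (h : BorelIsomorphic E F) : fineShape E = fineShape F := by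
  obtain ⟨f, ⟨-, hf⟩, hbij⟩ := h
  funext m
  have hF : ∀ x y, F.r x y ↔ (Quotient.mk F x) = Quotient.mk F y := fun x y => Quotient.eq.symm
  rw [fineShape_eq_mk_fiber (g := fun x => Quotient.mk F (f x))
    (fun x y => (hf x y).trans (hF _ _)), fineShape_eq_mk_fiber hF]
  have : ∀ q, #((fun x => Quotient.mk F (f x)) ⁻¹' {q}) = #(Quotient.mk F ⁻¹' {q}) := fun q =>
    mk_preimage_of_injective_of_subset_range f (Quotient.mk F ⁻¹' {q}) hbij.1
      (by rw [hbij.2.range_eq]; exact subset_univ _)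
  simp only [this]

theorem nonempty_equiv_fiber_sigmaFst {ι : Type*} {Z Y : ι → Type*} (p : Σ m, Z m) :
    Nonempty (Y p.1 ≃ (sigmaFst (Z := Z) (Y := Y) ⁻¹' {p} : Set (Σ m, Z m × Y m))) := by
  obtain ⟨m, z⟩ := p
  refine ⟨Equiv.ofBijective (fun y : Y m => ⟨⟨m, z, y⟩, rfl⟩) ⟨?_, ?_⟩⟩
  · intro y y' h
    simpa using congrArg Subtype.val h
  · rintro ⟨⟨m', z', y⟩, h⟩
    cases h
    exact ⟨y, rfl⟩

theorem measurable_sigmaFst {ι : Type*} {Z Y : ι → Type*} [∀ m, MeasurableSpace (Z m)]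
    [∀ m, MeasurableSpace (Y m)] : Measurable (sigmaFst (Z := Z) (Y := Y)) :=
  measurable_sigma_iff.2 fun m => (measurable_sigma_mk m).comp measurable_fst

/-! ### Borel parametrized equivalence relations -/

/-- The number of classes of size `m` of a parametrized equivalence relation is the size of the
`m`-th parameter space. -/
theorem fineShape_eq_mk_of_parametrization {X : Type u} {E : Setoid X} {Z Y : ↥CPlus.{u} → Type u}
    {φ : X → Σ m, Z m × Y m} (hY : ∀ m, #(Y m) = (m : Cardinal.{u})) (hφ : Function.Bijective φ)
    (hE : ∀ x y : X, E.r x y ↔ sigmaFst (φ x) = sigmaFst (φ y)) (m : ↥CPlus.{u}) :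
    fineShape E m = #(Z m) := by
  obtain ⟨e⟩ := nonempty_fiber_equiv_classes hE m
  have hfib : ∀ p, #((fun x => sigmaFst (φ x)) ⁻¹' {p}) = (p.1 : Cardinal.{u}) := by
    intro p
    obtain ⟨e'⟩ := nonempty_equiv_fiber_sigmaFst (Y := Y) p
    rw [← hY]
    exact (mk_congr (e'.trans ((Equiv.ofBijective φ hφ).subtypeEquiv fun _ => Iff.rfl).symm)).symm
  simp only [hfib, Subtype.val_inj] at e
  refine (mk_congr ((Equiv.ofBijective (fun z : Z m => ⟨⟨m, z⟩, rfl⟩) ⟨?_, ?_⟩).trans e)).symm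
  · intro z z' h
    simpa using congrArg Subtype.val h
  · rintro ⟨⟨m', z⟩, h⟩
    cases (h : m' = m)
    exact ⟨z, rfl⟩

theorem Measurable.measurable_symm_of_bijective {X Y : Type*} [MeasurableSpace X]
    [StandardBorelSpace X] [MeasurableSpace Y] [StandardBorelSpace Y] {f : X → Y}
    (hf : Measurable f) (hb : Function.Bijective f) : Measurable (Equiv.ofBijective f hb).symm := by
  intro s hs
  rw [← Equiv.image_eq_preimage_symm]
  exact (hf.measurableEmbedding hb.1).measurableSet_image' hs

/-- The fine shape determines the cardinality, hence the Borel isomorphism type, of each parameter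
space. -/
theorem borelIsomorphic_of_fineShape_eq {X Y : Type u} [MeasurableSpace X] [StandardBorelSpace X]
    [MeasurableSpace Y] [StandardBorelSpace Y] {E : Setoid X} {F : Setoid Y}
    (hE : IsBorelParametrized E) (hF : IsBorelParametrized F) (h : fineShape E = fineShape F) :
    BorelIsomorphic E F := by
  obtain ⟨Z, S, _, _, _, _, φ, hS, hφm, hφ, hE⟩ := hE
  obtain ⟨Z', S', _, _, _, _, ψ, hS', hψm, hψ, hF⟩ := hF
  have eZ : ∀ m, Nonempty (Z m ≃ Z' m) := fun m => Cardinal.eq.1 <| by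
    rw [← fineShape_eq_mk_of_parametrization hS hφ hE, h,
      fineShape_eq_mk_of_parametrization hS' hψ hF]
  have eS : ∀ m, Nonempty (S m ≃ S' m) := fun m => Cardinal.eq.1 <| by rw [hS, hS']
  let a : ∀ m, Z m ≃ᵐ Z' m := fun m => PolishSpace.Equiv.measurableEquiv (eZ m).some
  let b : ∀ m, S m ≃ᵐ S' m := fun m => PolishSpace.Equiv.measurableEquiv (eS m).some
  let c : (Σ m, Z m × S m) ≃ Σ m, Z' m × S' m :=
    Equiv.sigmaCongrRight fun m => ((a m).toEquiv.prodCongr (b m).toEquiv)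
  have hc : Measurable c := measurable_sigma_iff.2 fun m =>
    (measurable_sigma_mk m).comp ((a m).measurable.prodMap (b m).measurable)
  let d : (Σ m, Z m) ≃ Σ m, Z' m := Equiv.sigmaCongrRight fun m => (a m).toEquiv
  have hcd : ∀ p, sigmaFst (c p) = d (sigmaFst p) := fun p => rfl
  let e : Y ≃ Σ m, Z' m × S' m := Equiv.ofBijective ψ hψ
  have he : ∀ p, ψ (e.symm p) = p := e.apply_symm_apply
  refine ⟨fun x => e.symm (c (φ x)), ⟨?_, fun x y => ?_⟩, ?_⟩
  · exact (hψm.measurable_symm_of_bijective hψ).comp (hc.comp hφm)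
  · rw [hE, hF, he, he, hcd, hcd, d.apply_eq_iff_eq]
  · exact e.symm.bijective.comp (c.bijective.comp hφ)

/-- `CPlus.{u}` lives in `Type (u + 1)`; indexing by `J` keeps disjoint unions in `Type u`. -/
theorem exists_type_equiv_CPlus : ∃ (J : Type) (_ : J ≃ ↥CPlus.{u}), Countable J := by
  obtain ⟨f, hf⟩ := exists_injective_nat ↥CPlus.{u}
  exact ⟨range f, (Equiv.ofInjective f hf).symm, inferInstance⟩

theorem mk_mem_CPlus_or {X : Type u} [MeasurableSpace X] [StandardBorelSpace X] {s : Set X}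
    (hs : MeasurableSet s) : #s = 0 ∨ #s ∈ CPlus.{u} := by
  have := hs.standardBorel
  by_cases h0 : #s = 0
  · exact Or.inl h0
  by_cases h : Countable s
  · exact Or.inr ⟨h0, Or.inl (mk_le_aleph0_iff.2 h)⟩
  · exact Or.inr ⟨h0, Or.inr (mk_standardBorel_of_not_countable h)⟩

/-- The cardinality of the continuum, as an element of `𝒞⁺`. -/
noncomputable def continuumCPlus : ↥CPlus.{u} := ⟨𝔠, continuum_ne_zero, Or.inr rfl⟩

/-- If all but countably many fibers of a Borel map are countable, then the sets of points with
exactly `m` preimages are Borel. -/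
theorem measurableSet_mk_fiber_eq {X : Type u} {W : Type*} [MeasurableSpace X]
    [StandardBorelSpace X] [MeasurableSpace W] [StandardBorelSpace W]
    {g : X → W} (hg : Measurable g) (hc : {w | #(g ⁻¹' {w}) = 𝔠}.Countable) (m : ↥CPlus.{u}) :
    MeasurableSet {w | #(g ⁻¹' {w}) = (m : Cardinal.{u})} := by
  let := upgradeStandardBorel W
  have hle : ∀ m : ↥CPlus.{u}, m ≠ continuumCPlus → (m : Cardinal.{u}) ≤ ℵ₀ := fun m hm =>
    m.2.2.resolve_right fun h => hm (Subtype.ext h)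
  by_cases hm : m = continuumCPlus
  · rw [hm]
    exact hc.measurableSet
  refine AnalyticSet.measurableSet_of_compl ?_ (analyticSet_mk_fiber_ne hg (hle m hm))
  -- Fiber sizes range over the countable set `CPlus ∪ {0}`, with `none` standing for `0`. Excluding
  -- every other size is an analytic condition.
  have : {w | #(g ⁻¹' {w}) = (m : Cardinal.{u})} = {w | ∀ o : Option ↥CPlus.{u}, o ≠ some m →
      #(g ⁻¹' {w}) ≠ o.elim 0 (fun m' => (m' : Cardinal.{u}))} := by
    ext w
    constructor
    · rintro h (_ | m') hne h'
      · exact m.2.1 (h.symm.trans h')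
      · exact hne (congrArg some (Subtype.ext (h'.symm.trans h)))
    · intro h
      by_contra hne
      rcases mk_mem_CPlus_or (hg (measurableSet_singleton w)) with h0 | h1
      · exact h none (by simp) h0
      · exact h (some ⟨_, h1⟩) (fun h' => hne (congrArg Subtype.val (Option.some.inj h'))) rfl
  rw [this]
  refine analyticSet_forall fun o => analyticSet_const_imp fun _ => ?_
  rcases o with _ | m'
  · exact analyticSet_mk_fiber_ne hg zero_le
  · by_cases hm' : m' = continuumCPlus
    · rw [hm']
      exact hc.measurableSet.compl.analyticSet
    · exact analyticSet_mk_fiber_ne hg (hle m' hm')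

theorem isSmooth_ker {X W : Type u} [MeasurableSpace X] [MeasurableSpace W] [StandardBorelSpace W]
    {g : X → W} (hg : Measurable g) : IsSmooth (Setoid.ker g) :=
  ⟨W, inferInstance, inferInstance, g, hg, fun _ _ => Iff.rfl⟩

/-- A smooth equivalence relation with countably many uncountable classes has the same fine shape
as a smooth equivalence relation which is Borel parametrized. -/
theorem exists_isBorelParametrized_fineShape_eq {X W : Type u} [MeasurableSpace X]
    [StandardBorelSpace X] [MeasurableSpace W] [StandardBorelSpace W] {E : Setoid X} {g : X → W}
    (hg : Measurable g) (hE : ∀ x y, E.r x y ↔ g x = g y)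
    (hc : {w | #(g ⁻¹' {w}) = 𝔠}.Countable) :
    ∃ (Y : Type u) (_ : MeasurableSpace Y) (_ : StandardBorelSpace Y) (F : Setoid Y),
      IsSmooth F ∧ fineShape E = fineShape F ∧ IsBorelParametrized F := by
  obtain ⟨J, e, _⟩ := exists_type_equiv_CPlus.{u}
  choose S hSm hSb hS using exists_standardBorelSpace_mk.{u}
  let Z : ↥CPlus.{u} → Type u := fun m => {w : W | #(g ⁻¹' {w}) = (m : Cardinal.{u})}
  have hZ : ∀ m, StandardBorelSpace (Z m) := fun m =>
    (measurableSet_mk_fiber_eq hg hc m).standardBorel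
  let p : (Σ j, Z (e j) × S (e j)) → Σ j, Z (e j) := sigmaFst
  let φ : (Σ j, Z (e j) × S (e j)) ≃ Σ m, Z m × S m :=
    Equiv.sigmaCongrLeft (β := fun m => Z m × S m) e
  let d : (Σ j, Z (e j)) ≃ Σ m, Z m := Equiv.sigmaCongrLeft (β := Z) e
  have hφ : Measurable φ := measurable_sigma_iff.2 fun j =>
    measurable_sigma_mk (X := fun m => Z m × S m) (e j)
  have hF : ∀ x y, (Setoid.ker p).r x y ↔ sigmaFst (φ x) = sigmaFst (φ y) := fun x y =>
    (d.apply_eq_iff_eq (x := p x) (y := p y)).symm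
  refine ⟨_, inferInstance, inferInstance, Setoid.ker p, isSmooth_ker measurable_sigmaFst, ?_,
    Z, S, inferInstance, hZ, hSm, hSb, φ, hS, hφ, φ.bijective, hF⟩
  funext m
  rw [fineShape_eq_mk_of_parametrization hS φ.bijective hF, fineShape_eq_mk_fiber hE]

/-- Being Borel parametrized is invariant under Borel isomorphism. -/
theorem BorelIsomorphic.isBorelParametrized {X Y : Type u} [MeasurableSpace X] [MeasurableSpace Y]
    {E : Setoid X} {F : Setoid Y} (h : BorelIsomorphic E F) (hF : IsBorelParametrized F) :
    IsBorelParametrized E := by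
  obtain ⟨f, ⟨hfm, hf⟩, hfb⟩ := h
  obtain ⟨Z, S, hZm, hZ, hSm, hSb, φ, hS, hφm, hφ, hF⟩ := hF
  exact ⟨Z, S, hZm, hZ, hSm, hSb, φ ∘ f, hS, hφm.comp hfm, hφ.comp hfb,
    fun x y => (hf x y).trans (hF _ _)⟩

/-! ### The number of uncountable classes -/

theorem mk_fiber_eq_continuum_iff {X : Type u} {W : Type*} [MeasurableSpace X]
    [StandardBorelSpace X] [MeasurableSpace W] [StandardBorelSpace W] {g : X → W}
    (hg : Measurable g) (w : W) : #(g ⁻¹' {w}) = 𝔠 ↔ ¬ (g ⁻¹' {w}).Countable := by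
  refine ⟨fun h hc => ?_, fun h => ?_⟩
  · exact aleph0_lt_continuum.not_ge (h ▸ le_aleph0_iff_set_countable.2 hc)
  · have := (hg (measurableSet_singleton w)).standardBorel
    exact mk_standardBorel_of_not_countable h

/-- A Borel map has countably many or continuum many uncountable fibers. -/
theorem mk_setOf_mk_fiber_eq_continuum {X W : Type u} [MeasurableSpace X]
    [StandardBorelSpace X] [MeasurableSpace W] [StandardBorelSpace W] {g : X → W}
    (hg : Measurable g) :
    {w | #(g ⁻¹' {w}) = 𝔠}.Countable ∨ #{w | #(g ⁻¹' {w}) = 𝔠} = 𝔠 := by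
  refine or_iff_not_imp_left.2 fun hc => ?_
  let := upgradeStandardBorel W
  simp only [mk_fiber_eq_continuum_iff hg] at hc ⊢
  obtain ⟨S, hS, himg⟩ := exists_measurableSet_image_eq_not_countable hg
  have := hS.standardBorel
  have hmeas : Measurable fun x : S => g (x.1 0) :=
    hg.comp ((measurable_pi_apply 0).comp measurable_subtype_coe)
  have hrange : range (fun x : S => g (x.1 0)) = {w | ¬ (g ⁻¹' {w}).Countable} := by
    rw [← himg, image_eq_range]
  rw [← hrange] at hc ⊢
  obtain ⟨f, hf, hsub⟩ := exists_nat_bool_injection_range_of_measurable hmeas hc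
  refine le_antisymm ((mk_set_le _).trans mk_standardBorel_le) ?_
  have := mk_le_mk_of_subset hsub
  have h' := mk_range_eq_of_injective hf
  rw [mk_nat_bool, lift_continuum, Cardinal.lift_id'] at h'
  rwa [h'] at this

/-! ### An analytic set that is not Borel -/

theorem exists_analyticSet_not_measurableSet :
    ∃ A : Set (ℕ → ℕ), AnalyticSet A ∧ ¬ MeasurableSet A := by
  obtain ⟨U, hU⟩ := (countable_countableBasis ((ℕ → ℕ) × (ℕ → ℕ))).exists_eq_range
    (((isBasis_countableBasis _).exists_subset_of_mem_open (mem_univ (0, 0)) isOpen_univ).imp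
      fun _ h => h.1)
  have hbasis := isBasis_countableBasis ((ℕ → ℕ) × (ℕ → ℕ))
  rw [hU] at hbasis
  have hUo : ∀ n, IsOpen (U n) := fun n => hbasis.isOpen (mem_range_self n)
  -- Diagonalization: the first coordinate also serves as a code for a closed subset of the plane.
  -- If the complement of the projection of `B` is that of a closed `C`, then for `y` coding `C` the
  -- sections of `B` and `C` at `y` agree.
  let B : Set ((ℕ → ℕ) × (ℕ → ℕ)) := {p | ∀ n, p.1 n = 0 → p ∉ U n}
  have hB : MeasurableSet B := by
    refine measurableSet_setOfPred.2 (.forall fun n => .imp ?_ (.not ?_))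
    · exact measurableSet_setOfPred.1 (measurableSet_eq_fun (by fun_prop) measurable_const)
    · exact measurableSet_setOfPred.1 (hUo n).measurableSet
  refine ⟨Prod.fst '' B, hB.analyticSet_image measurable_fst, fun hmeas => ?_⟩
  obtain ⟨C, hC, hCA⟩ : ∃ C : Set ((ℕ → ℕ) × (ℕ → ℕ)), IsClosed C ∧
      Prod.fst '' C = (Prod.fst '' B)ᶜ := by
    have h := hmeas.compl.analyticSet
    rw [AnalyticSet] at h
    rcases h with h | ⟨f, hf, h⟩
    · exact ⟨∅, isClosed_empty, by rw [h, image_empty]⟩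
    · refine ⟨{p | f p.2 = p.1}, isClosed_eq (by fun_prop) continuous_fst, ?_⟩
      rw [← h]
      ext y
      simp
  classical
  let y : ℕ → ℕ := fun n => if U n ⊆ Cᶜ then 0 else 1
  have hy : ∀ z, (y, z) ∈ B ↔ (y, z) ∈ C := by
    intro z
    constructor
    · intro h
      by_contra hz
      obtain ⟨_, ⟨n, rfl⟩, hn, hsub⟩ := hbasis.exists_subset_of_mem_open
        (show (y, z) ∈ Cᶜ from hz) hC.isOpen_compl
      exact h n (by simp [y, hsub]) hn
    · intro h n hn hz
      have : U n ⊆ Cᶜ := by by_contra h'; simp [y, h'] at hn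
      exact this hz h
  have : y ∈ Prod.fst '' B ↔ y ∈ Prod.fst '' C := by simp [hy]
  rw [hCA] at this
  exact iff_not_self this

theorem MeasureTheory.AnalyticSet.exists_measurable_range {V : Type*} [TopologicalSpace V]
    [MeasurableSpace V] [BorelSpace V] {s : Set V} (hs : AnalyticSet s) :
    ∃ (C : Type u) (_ : MeasurableSpace C) (_ : StandardBorelSpace C) (h : C → V),
      Measurable h ∧ range h = s := by
  obtain ⟨β, _, _, f, hf, rfl⟩ := analyticSet_iff_exists_polishSpace_range.1 hs
  borelize β
  have : PolishSpace (ULift.{u} β) := IsClosedEmbedding.uliftDown.polishSpace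
  refine ⟨ULift.{u} β, inferInstance, inferInstance, f ∘ ULift.down,
    hf.measurable.comp measurable_down, ?_⟩
  rw [range_comp, ULift.down_surjective.range_eq, image_univ]

/-! ### Smooth equivalence relations with continuum many uncountable classes -/

/-- If `E` has continuum many uncountable classes, then the fine shape of `E` is that of the kernel
of a Borel map `k` whose range in a given standard Borel space `W'` is a given analytic set, and
whose range in the complementary space is full. -/
theorem exists_measurable_fineShape_eq {X W : Type u} [MeasurableSpace X]
    [StandardBorelSpace X] [MeasurableSpace W] [StandardBorelSpace W] {E : Setoid X} {g : X → W}
    (hg : Measurable g) (hE : ∀ x y, E.r x y ↔ g x = g y) (hc : #{w | #(g ⁻¹' {w}) = 𝔠} = 𝔠)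
    {J : Type} [Countable J] (e : J ≃ ↥CPlus.{u}) {W' : Type u} [TopologicalSpace W']
    [PolishSpace W'] [MeasurableSpace W'] [BorelSpace W'] {A : Set W'} (hA : AnalyticSet A) :
    ∃ (Y : Type u) (_ : MeasurableSpace Y) (_ : StandardBorelSpace Y)
      (k : Y → (Σ _ : J, W) ⊕ W'), Measurable k ∧ fineShape E = fineShape (Setoid.ker k) ∧
        range k = range Sum.inl ∪ Sum.inr '' A := by
  let := upgradeStandardBorel W
  choose S hSm hSb hS using exists_standardBorelSpace_mk.{u}
  -- Over `(j, w)` a fiber of size `e j` is placed. When that size is wrong for `w`, that is, on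
  -- `K`, the fiber is enlarged to size continuum. Only analyticity of `K` is needed, as enlarging
  -- uses a Borel map `h` with range `K` together with `A`.
  let K : Set (Σ _ : J, W) := {p | e p.1 ≠ continuumCPlus ∧ #(g ⁻¹' {p.2}) ≠ (e p.1 : Cardinal.{u})}
  have hK : AnalyticSet K := by
    have : K = ⋃ j, Sigma.mk j '' {w | e j ≠ continuumCPlus ∧ #(g ⁻¹' {w}) ≠ (e j : Cardinal.{u})} := by
      ext ⟨j, w⟩
      simp only [mem_iUnion, mem_image]
      exact ⟨fun h => ⟨j, w, h, rfl⟩, by rintro ⟨j, w, h, ⟨⟩⟩; exact h⟩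
    rw [this]
    refine .iUnion fun j => AnalyticSet.image_of_continuous ?_ continuous_sigmaMk
    exact analyticSet_const_and fun hj => analyticSet_mk_fiber_ne hg
      ((e j).2.2.resolve_right fun h => hj (Subtype.ext h))
  have hKA : AnalyticSet (Sum.inl '' K ∪ Sum.inr '' A : Set ((Σ _ : J, W) ⊕ W')) := by
    have := analyticSet_or (hK.image_of_continuous (continuous_inl (Y := W')))
      (hA.image_of_continuous (continuous_inr (X := Σ _ : J, W)))
    exact this
  obtain ⟨C, _, _, h, hh, hrange⟩ := hKA.exists_measurable_range.{u}
  let R := S continuumCPlus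
  have hR : #R = 𝔠 := hS _
  let f : (Σ j : J, W × S (e j)) → (Σ _ : J, W) := sigmaFst
  let k : (Σ j : J, W × S (e j)) ⊕ (C × R) → (Σ _ : J, W) ⊕ W' :=
    Sum.elim (fun a => Sum.inl (f a)) fun c => h c.1
  have hk : Measurable k := (measurable_inl.comp measurable_sigmaFst).sumElim
    (hh.comp measurable_fst)
  have hfibR : ∀ v ∈ range h, #(k ⁻¹' {v}) = 𝔠 := by
    rintro _ ⟨c, rfl⟩
    refine le_antisymm ((mk_set_le _).trans mk_standardBorel_le) ?_
    rw [← hR]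
    refine mk_le_of_injective (f := fun r : R => ⟨Sum.inr (c, r), rfl⟩) fun r r' hr => ?_
    simpa using congrArg Subtype.val hr
  have hfibL : ∀ p, Sum.inl p ∉ range h → #(k ⁻¹' {Sum.inl p}) = (e p.1 : Cardinal.{u}) := by
    intro p hp
    have : k ⁻¹' {Sum.inl p} = Sum.inl '' (f ⁻¹' {p}) := by
      ext (a | c)
      · simp [k]
      · simpa [k] using fun h' => hp ⟨c.1, h'⟩
    rw [this, mk_image_eq Sum.inl_injective, ← hS]
    obtain ⟨e'⟩ := nonempty_equiv_fiber_sigmaFst (Y := fun j => S (e j)) p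
    exact (mk_congr e').symm
  have hfib0 : ∀ w, Sum.inr w ∉ range h → #(k ⁻¹' {Sum.inr w}) = 0 := by
    intro w hw
    rw [mk_set_eq_zero_iff, eq_empty_iff_forall_notMem]
    rintro (a | c) h'
    · cases h'
    · exact hw ⟨c.1, h'⟩
  have hinl : ∀ p, Sum.inl p ∈ range h ↔ p ∈ K := by simp [hrange]
  refine ⟨_, inferInstance, inferInstance, k, hk, ?_, ?_⟩
  · funext m
    rw [fineShape_eq_mk_fiber hE, fineShape_eq_mk_fiber (g := k) fun x y => Iff.rfl]
    by_cases hm : m = continuumCPlus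
    · subst hm
      refine hc.trans (le_antisymm ?_ ((mk_set_le _).trans mk_standardBorel_le))
      refine hc.ge.trans ((mk_set_le _).trans ?_)
      -- The copy of `W` at index `continuumCPlus` avoids `K` and alone supplies continuum many
      -- uncountable fibers.
      refine mk_le_of_injective (f := fun w : W =>
        ⟨Sum.inl ⟨e.symm continuumCPlus, w⟩, ?_⟩) fun w w' hw => ?_
      · rw [mem_ofPred_eq, hfibL _ (by simp [hinl, K])]
        simp
      · simpa using congrArg Subtype.val hw
    · have hm' : (m : Cardinal.{u}) ≠ 𝔠 := fun h => hm (Subtype.ext h)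
      have : {v | #(k ⁻¹' {v}) = (m : Cardinal.{u})} =
          (fun w => Sum.inl ⟨e.symm m, w⟩) '' {w | #(g ⁻¹' {w}) = (m : Cardinal.{u})} := by
        ext v
        by_cases hv : v ∈ range h
        · rw [mem_ofPred_eq, hfibR v hv]
          refine iff_of_false hm'.symm ?_
          rintro ⟨w, hw, rfl⟩
          have := ((hinl _).1 hv).2
          simp only [Equiv.apply_symm_apply] at this
          exact this hw
        rcases v with ⟨j, w⟩ | w
        · rw [mem_ofPred_eq, hfibL _ hv, Subtype.val_inj]
          have hv' := mt (hinl _).2 hv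
          constructor
          · rintro rfl
            refine ⟨w, ?_, by simp⟩
            by_contra h'
            exact hv' ⟨hm, h'⟩
          · rintro ⟨w', -, h'⟩
            cases h'
            simp
        · rw [mem_ofPred_eq, hfib0 _ hv]
          exact iff_of_false (Ne.symm m.2.1) (by simp)
      rw [this]
      refine (mk_image_eq fun w w' hw => ?_).symm
      simpa using hw
  · have hne : ∀ m, Nonempty (S m) := fun m => mk_ne_zero_iff.1 (by rw [hS]; exact m.2.1)
    have hRne : Nonempty R := hne _
    have hf : Function.Surjective f := fun p => ⟨⟨p.1, p.2, (hne _).some⟩, rfl⟩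
    have h1 : range k = range (fun a => (Sum.inl (f a) : (Σ _ : J, W) ⊕ W')) ∪
        range fun c : C × R => h c.1 := Sum.elim_range _ _
    have h2 : range (fun c : C × R => h c.1) = range h :=
      Prod.fst_surjective.range_comp h
    have h3 : range (fun a => (Sum.inl (f a) : (Σ _ : J, W) ⊕ W')) = range Sum.inl :=
      hf.range_comp Sum.inl
    rw [h1, h2, h3, hrange, ← union_assoc, union_eq_self_of_subset_right (image_subset_range _ _)]

/-- Two Borel maps with the same kernel, the first one surjective, have ranges that are Borel in
the second space. -/
theorem measurableSet_range_of_same_kernel {X V V' : Type*} [MeasurableSpace X]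
    [StandardBorelSpace X] [MeasurableSpace V] [StandardBorelSpace V] [MeasurableSpace V']
    [StandardBorelSpace V'] {k : X → V} {k' : X → V'} (hk : Measurable k) (hk' : Measurable k')
    (hsurj : Function.Surjective k) (h : ∀ x y, k x = k y ↔ k' x = k' y) :
    MeasurableSet (range k') := by
  let q : V → V' := fun v => k' (Function.surjInv hsurj v)
  have hq : q ∘ k = k' := funext fun x => (h _ _).1 (Function.surjInv_eq hsurj (k x))
  -- A Borel surjection between standard Borel spaces is a quotient map for Borel structures; the
  -- Lusin–Souslin theorem then applies to the injection `q`.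
  have hqm : Measurable q := (hk.measurable_comp_iff_of_surjective hsurj).1 (by rwa [hq])
  have hqi : Function.Injective q := fun v v' hv => by
    have := (h _ _).2 hv
    rwa [Function.surjInv_eq hsurj, Function.surjInv_eq hsurj] at this
  rw [← hq, hsurj.range_comp]
  exact (hqm.measurableEmbedding hqi).measurableSet_range

theorem exists_fineShape_eq_not_borelIsomorphic {X W : Type u} [MeasurableSpace X]
    [StandardBorelSpace X] [MeasurableSpace W] [StandardBorelSpace W] {E : Setoid X} {g : X → W}
    (hg : Measurable g) (hE : ∀ x y, E.r x y ↔ g x = g y) (hc : #{w | #(g ⁻¹' {w}) = 𝔠} = 𝔠) :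
    ∃ (Y : Type u) (_ : MeasurableSpace Y) (_ : StandardBorelSpace Y) (F : Setoid Y),
      IsSmooth F ∧ fineShape E = fineShape F ∧ ¬ BorelIsomorphic E F := by
  obtain ⟨J, e, _⟩ := exists_type_equiv_CPlus.{u}
  have : PolishSpace (ULift.{u} (ℕ → ℕ)) := IsClosedEmbedding.uliftDown.polishSpace
  obtain ⟨A, hA, hAm⟩ := exists_analyticSet_not_measurableSet
  -- The choice `univ` makes `k` surjective; the choice of a copy of `A` makes the range of `k'`
  -- non-Borel.
  obtain ⟨Y, _, _, k, hk, hfs, hr⟩ := exists_measurable_fineShape_eq hg hE hc e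
    (isClosed_univ.analyticSet (α := ULift.{u} (ℕ → ℕ)))
  obtain ⟨Y', _, _, k', hk', hfs', hr'⟩ := exists_measurable_fineShape_eq hg hE hc e
    (hA.preimage (continuous_uliftDown : Continuous (ULift.down : ULift.{u} (ℕ → ℕ) → ℕ → ℕ)))
  by_contra! H
  obtain ⟨f, ⟨hf, hEf⟩, hfb⟩ := H Y inferInstance inferInstance _ (isSmooth_ker hk) hfs
  obtain ⟨f', ⟨hf', hEf'⟩, hfb'⟩ := H Y' inferInstance inferInstance _ (isSmooth_ker hk') hfs'
  have hsurj : Function.Surjective k := by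
    rw [← range_eq_univ, hr, image_univ, range_inl_union_range_inr]
  have hmeas := measurableSet_range_of_same_kernel (hk.comp hf) (hk'.comp hf')
    (hsurj.comp hfb.2) fun x y => (hEf x y).symm.trans (hEf' x y)
  rw [hfb'.2.range_comp, hr'] at hmeas
  refine hAm ?_
  have := measurable_up (measurable_inr hmeas)
  convert! this using 1
  ext y
  simp

end SmoothRelations

theorem theorem3p5 :
    (∀ (X Y : Type u) [MeasurableSpace X] [StandardBorelSpace X]
        [MeasurableSpace Y] [StandardBorelSpace Y] (E : Setoid X) (F : Setoid Y),
        IsBorelParametrized E → IsBorelParametrized F →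
          (BorelIsomorphic E F ↔ fineShape E = fineShape F)) ∧
    (∀ (X : Type u) [MeasurableSpace X] [StandardBorelSpace X] (E : Setoid X),
        IsSmooth E → ¬ IsBorelParametrized E →
          ∃ (Y : Type u) (_ : MeasurableSpace Y) (_ : StandardBorelSpace Y) (F : Setoid Y),
            IsSmooth F ∧ fineShape E = fineShape F ∧ ¬ BorelIsomorphic E F) := by
  refine ⟨fun X Y _ _ _ _ E F hE hF =>
    ⟨BorelIsomorphic.fineShape_eq, borelIsomorphic_of_fineShape_eq hE hF⟩, ?_⟩
  rintro X _ _ E ⟨W, _, _, g, hg, hE⟩ hpar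
  rcases mk_setOf_mk_fiber_eq_continuum hg with hc | hc
  · obtain ⟨Y, _, _, F, hF, hfs, hFp⟩ := exists_isBorelParametrized_fineShape_eq hg hE hc
    exact ⟨Y, inferInstance, inferInstance, F, hF, hfs, fun h => hpar (h.isBorelParametrized hFp)⟩
  · exact exists_fineShape_eq_not_borelIsomorphic hg hE hc
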